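/- **Lemma (Poisson identities).** Let $a,a^\dagger$ be the annihilation and creation operators of the harmonic oscillator, $[a,a^\dagger]=1$, let $X_\phi=\tfrac12(a^\dagger e^{i\phi}+ae^{-i\phi})$, $\phi\in[0,\pi)$, be the quadratures, and $dE_\phi(x)$ the spectral measure of $X_\phi$. For an estimator $e_\phi(x)$ (possibly containing a distribution in $\phi$) and a state $\rho$ put $$\overline{e}(\rho)=\int_0^\pi\frac{d\phi}{\pi}\int_{\mathbb R}\mathrm{Tr}[\rho\,dE_\phi(x)]\;e_\phi(x).$$ On a set of states, $e\simeq e'$ means that both double averages converge absolutely and that $e-e'$ is a null estimator there, i.e. $\overline{e}(\rho)-\overline{e'}(\rho)=0$ for all $\rho$ in the set. Let $\delta_\pi$ be the Dirac delta at $\phi=0$ on $[0,\pi)$, $\int_0^\pi\delta_\pi(\phi)g(\phi)\,d\phi=g(0)$, and for $0<\epsilon<1$ let $\delta_\pi^{\epsilon}(\phi)=\frac1\pi\sum_{n\in\mathbb Z}\epsilon^{|n|}e^{2in\phi}$ be its Poisson form. Let $f(z)=\sum_k a_kz^k$ be an entire function. Then $$f(x^2)\,\delta_\pi(\phi)\simeq\frac1\pi\left[\frac{f(x^2e^{2i\phi})}{1-e^{-2i\phi}}+\frac{f(x^2e^{-2i\phi})}{1-e^{2i\phi}}\right]$$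 on the states with $\sum_k(k+1)|a_k|\int_0^\pi\frac{d\phi}\pi\langle X_\phi^{2k}\rangle<\infty$, and $$x f(x^2)\,\delta_\pi(\phi)\simeq\frac1\pi\left[\frac{xe^{i\phi}f(x^2e^{2i\phi})}{1-e^{-2i\phi}}+\frac{xe^{-i\phi}f(x^2e^{-2i\phi})}{1-e^{2i\phi}}\right]$$ on the states with $\sum_k(k+2)|a_k|\int_0^\pi\frac{d\phi}\pi\langle X_\phi^{2k+2}\rangle<\infty$. In particular, on all states, $\delta_\pi(\phi)\simeq\frac1\pi$. The three relations also hold, on the same states and in the limit $\epsilon\to1^-$ of the double averages, with the left-hand sides replaced by $f(x^2)\,\delta^\epsilon_\pi(\phi)$, $x f(x^2)\,e^{i\phi}\delta^\epsilon_\pi(\phi)$ and $\delta^\epsilon_\pi(\phi)$, respectively. -/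

import Mathlib

noncomputable section

open MeasureTheory Filter Topology Polynomial
open scoped ENNReal ContDiff

namespace Homodyne

/-! ### Number-state wave functions

With `X_0 = (a + a†) / 2` and `[a, a†] = 1`, the `n`-th number state has in the position
representation the wave function
`u_n(x) = (2/π)^(1/4) (n!)^(-1/2) He_n(2 x) exp(-x²)`, `He_n` the probabilists' Hermite polynomial.
They are shown to form an orthonormal basis of `L²(ℝ)`. -/

/-- The probabilists' Hermite polynomial `He_n` over `ℝ`. -/
def hermiteR (n : ℕ) : ℝ[X] := (Polynomial.hermite n).map (Int.castRingHom ℝ)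

theorem hermiteR_zero : hermiteR 0 = 1 := by simp [hermiteR]

theorem hermiteR_succ (n : ℕ) :
    hermiteR (n + 1) = X * hermiteR n - derivative (hermiteR n) := by
  simp [hermiteR, Polynomial.hermite_succ, Polynomial.derivative_map]

theorem derivative_hermiteR (n : ℕ) :
    derivative (hermiteR (n + 1)) = ((n : ℝ[X]) + 1) * hermiteR n := by
  induction n with
  | zero => simp [hermiteR]
  | succ n ih =>
    rw [hermiteR_succ (n + 1), derivative_sub, derivative_mul, derivative_X, ih, derivative_mul]
    rw [hermiteR_succ n]
    have : derivative ((n : ℝ[X]) + 1) = 0 := by simp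
    rw [this]
    push_cast
    ring

theorem hermiteR_recurrence (n : ℕ) :
    X * hermiteR (n + 1) = hermiteR (n + 2) + ((n : ℝ[X]) + 1) * hermiteR n := by
  rw [hermiteR_succ (n + 1), derivative_hermiteR]; ring

theorem integrable_poly_gauss (p : ℝ[X]) {b : ℝ} (hb : 0 < b) :
    Integrable fun x : ℝ => p.eval x * Real.exp (-b * x ^ 2) := by
  induction p using Polynomial.induction_on' with
  | add p q hp hq => simp only [eval_add, add_mul]; exact hp.add hq
  | monomial n a =>
    have h := integrable_rpow_mul_exp_neg_mul_sq hb (s := n) (by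
      have : (0 : ℝ) ≤ n := Nat.cast_nonneg n
      linarith)
    simpa [mul_assoc] using h.const_mul a

theorem integral_poly_gauss_ibp (p : ℝ[X]) :
    ∫ y : ℝ, (X * p - derivative p).eval y * Real.exp (-(1 / 2) * y ^ 2) = 0 := by
  have h := integral_eq_zero_of_hasDerivAt_of_integrable
    (f := fun y : ℝ => -(p.eval y * Real.exp (-(1 / 2) * y ^ 2)))
    (f' := fun y : ℝ => (X * p - derivative p).eval y * Real.exp (-(1 / 2) * y ^ 2)) ?_ ?_ ?_
  · exact h
  · intro y
    have h1 : HasDerivAt (fun y : ℝ => Real.exp (-(1 / 2) * y ^ 2))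
        (Real.exp (-(1 / 2) * y ^ 2) * (-(1 / 2) * (2 * y))) y := by
      have := ((hasDerivAt_pow 2 y).const_mul (-(1 / 2 : ℝ))).exp
      simpa using this
    have h2 := ((p.hasDerivAt y).mul h1).neg
    refine h2.congr_deriv ?_
    simp only [eval_sub, eval_mul, eval_X]
    ring
  · exact integrable_poly_gauss _ (by norm_num)
  · exact (integrable_poly_gauss _ (by norm_num)).neg

theorem integral_hermiteR_mul (n m : ℕ) :
    ∫ y : ℝ, (hermiteR n * hermiteR m).eval y * Real.exp (-(1 / 2) * y ^ 2) =
      if n = m then (n.factorial : ℝ) * √(2 * Real.pi) else 0 := by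
  induction n generalizing m with
  | zero =>
    cases m with
    | zero =>
      have := integral_gaussian (1 / 2)
      simp only [hermiteR_zero, mul_one, eval_one, one_mul, this]
      simp [mul_comm]
    | succ m =>
      rw [hermiteR_zero, one_mul, hermiteR_succ, integral_poly_gauss_ibp]
      simp
  | succ n ih =>
    have key : ∫ y : ℝ, (hermiteR (n + 1) * hermiteR m).eval y * Real.exp (-(1 / 2) * y ^ 2) =
        ∫ y : ℝ, (hermiteR n * derivative (hermiteR m)).eval y *
          Real.exp (-(1 / 2) * y ^ 2) := by
      rw [← sub_eq_zero, ← integral_sub (integrable_poly_gauss _ (by norm_num))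
        (integrable_poly_gauss _ (by norm_num)), ← integral_poly_gauss_ibp (hermiteR n * hermiteR m)]
      congr 1
      ext y
      rw [← sub_mul, ← eval_sub]
      congr 2
      rw [hermiteR_succ, derivative_mul]; ring
    rw [key]
    cases m with
    | zero => simp [hermiteR_zero]
    | succ m =>
      have : ∀ y : ℝ, (hermiteR n * derivative (hermiteR (m + 1))).eval y *
          Real.exp (-(1 / 2) * y ^ 2) =
          ((m : ℝ) + 1) * ((hermiteR n * hermiteR m).eval y * Real.exp (-(1 / 2) * y ^ 2)) := by
        intro y; rw [derivative_hermiteR]; simp; ring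
      simp_rw [this]
      rw [integral_const_mul, ih]
      by_cases h : n = m
      · subst h; simp [Nat.factorial_succ]; ring
      · simp [h]

/-- The wave function `u_n` of the `n`-th number state. -/
def numberFn (n : ℕ) (x : ℝ) : ℝ :=
  √(√(2 / Real.pi) / (n.factorial : ℝ)) * (hermiteR n).eval (2 * x) * Real.exp (-x ^ 2)

theorem integral_numberFn_mul (n m : ℕ) :
    ∫ x : ℝ, numberFn n x * numberFn m x = if n = m then 1 else 0 := by
  have h1 : ∀ x : ℝ, numberFn n x * numberFn m x =
      √(√(2 / Real.pi) / (n.factorial : ℝ)) * √(√(2 / Real.pi) / (m.factorial : ℝ)) *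
      (fun y : ℝ => (hermiteR n * hermiteR m).eval y * Real.exp (-(1 / 2) * y ^ 2)) (2 * x) := by
    intro x
    have : Real.exp (-(1 / 2) * (2 * x) ^ 2) = Real.exp (-x ^ 2) * Real.exp (-x ^ 2) := by
      rw [← Real.exp_add]; congr 1; ring
    simp only [numberFn, eval_mul, this]; ring
  simp_rw [h1]
  rw [integral_const_mul, Measure.integral_comp_mul_left
    (fun y : ℝ => (hermiteR n * hermiteR m).eval y * Real.exp (-(1 / 2) * y ^ 2)),
    integral_hermiteR_mul]
  by_cases h : n = m
  · subst h
    simp only [if_true, smul_eq_mul]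
    rw [Real.mul_self_sqrt (by positivity)]
    have hn : (n.factorial : ℝ) ≠ 0 := by positivity
    have h2 : √(2 / Real.pi) * √(2 * Real.pi) = 2 := by
      rw [← Real.sqrt_mul (by positivity)]
      have : 2 / Real.pi * (2 * Real.pi) = 2 ^ 2 := by
        field_simp
      rw [this]; exact Real.sqrt_sq (by norm_num)
    have h3 : |(2 : ℝ)⁻¹| = 2⁻¹ := abs_of_pos (by norm_num)
    rw [h3]
    field_simp
    rw [h2]
  · simp [h]

theorem continuous_numberFn (n : ℕ) : Continuous (numberFn n) := by
  unfold numberFn; fun_prop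

theorem numberFn_mul_eq (n m : ℕ) (x : ℝ) : numberFn n x * numberFn m x =
    (C (√(√(2 / Real.pi) / (n.factorial : ℝ)) * √(√(2 / Real.pi) / (m.factorial : ℝ))) *
      ((hermiteR n * hermiteR m).comp (C 2 * X))).eval x * Real.exp (-2 * x ^ 2) := by
  have : Real.exp (-2 * x ^ 2) = Real.exp (-x ^ 2) * Real.exp (-x ^ 2) := by
    rw [← Real.exp_add]; congr 1; ring
  rw [this]
  simp only [numberFn, eval_mul, eval_C, eval_comp, eval_X]
  ring

theorem memLp_numberFn (n : ℕ) :
    MemLp (fun x : ℝ => (numberFn n x : ℂ)) 2 volume := by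
  rw [memLp_two_iff_integrable_sq_norm
    (f := fun x : ℝ => (numberFn n x : ℂ))
    (Complex.continuous_ofReal.comp (continuous_numberFn n)).aestronglyMeasurable]
  refine (integrable_poly_gauss
    (C (√(√(2 / Real.pi) / (n.factorial : ℝ)) * √(√(2 / Real.pi) / (n.factorial : ℝ))) *
      ((hermiteR n * hermiteR n).comp (C 2 * X))) (b := 2) (by norm_num)).congr ?_
  refine Eventually.of_forall fun x => ?_
  simp only [← numberFn_mul_eq, Complex.norm_real, Real.norm_eq_abs, sq_abs]
  ring

/-- The `n`-th number state as a vector of `L²(ℝ)`. -/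
def numberL2 (n : ℕ) : Lp ℂ 2 (volume : Measure ℝ) := (memLp_numberFn n).toLp _

theorem orthonormal_numberL2 : Orthonormal ℂ numberL2 := by
  rw [orthonormal_iff_ite]
  intro n m
  rw [L2.inner_def]
  have : ∀ᵐ x : ℝ, inner ℂ (numberL2 n x) (numberL2 m x) =
      ((numberFn n x * numberFn m x : ℝ) : ℂ) := by
    filter_upwards [(memLp_numberFn n).coeFn_toLp, (memLp_numberFn m).coeFn_toLp] with x hn hm
    simp only [numberL2, hn, hm]
    simp [mul_comm]
  have h2 := integral_ofReal (𝕜 := ℂ) (μ := volume) (f := fun x => numberFn n x * numberFn m x)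
  rw [integral_numberFn_mul] at h2
  rw [integral_congr_ae this]
  refine h2.trans ?_
  split_ifs <;> simp

theorem ae_zero_of_fourier_zero {h : ℝ → ℂ} (hi : Integrable h)
    (h0 : ∀ t : ℝ, ∫ x : ℝ, Complex.exp (t * x * Complex.I) * h x = 0) : h =ᵐ[volume] 0 := by
  have hF : ∀ ξ : ℝ, FourierTransform.fourier h ξ = 0 := by
    intro ξ
    rw [Real.fourier_real_eq_integral_exp_smul, ← h0 (-2 * Real.pi * ξ)]
    refine integral_congr_ae (Eventually.of_forall fun x => ?_)
    simp only [smul_eq_mul]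
    congr 2
    push_cast
    ring
  refine ae_eq_zero_of_integral_contDiff_smul_eq_zero hi.locallyIntegrable ?_
  intro g hg hgs
  have hg₁ : HasCompactSupport (Complex.ofRealCLM ∘ g) := hgs.comp_left rfl
  have hg₂ : ContDiff ℝ ∞ (Complex.ofRealCLM ∘ g) := by fun_prop
  set G : SchwartzMap ℝ ℂ := hg₁.toSchwartzMap hg₂ with hG
  set K : SchwartzMap ℝ ℂ := FourierTransformInv.fourierInv G with hK
  have hGK : FourierTransform.fourier K = G := FourierTransform.fourier_fourierInv_eq G
  have hKG : ∀ x, FourierTransform.fourier (K : ℝ → ℂ) x = G x := by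
    intro x; rw [← SchwartzMap.fourier_coe, hGK]
  have hflip := VectorFourier.integral_fourierIntegral_smul_eq_flip (L := innerₗ ℝ)
    (μ := volume) (ν := volume) (f := (K : ℝ → ℂ)) (g := h)
      Real.continuous_fourierChar continuous_inner K.integrable hi
  have e1 : ∀ x, VectorFourier.fourierIntegral Real.fourierChar volume (innerₗ ℝ) (K : ℝ → ℂ) x
      = G x := hKG
  have e2 : ∀ x, VectorFourier.fourierIntegral Real.fourierChar volume (innerₗ ℝ).flip h x = 0 := by
    intro x
    rw [flip_innerₗ]
    exact hF x
  simp_rw [e1, e2] at hflip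
  simpa [hG] using hflip

theorem memLp_exp (t : ℝ) :
    MemLp (fun x : ℝ => Real.exp (|t * x| - x ^ 2)) 2 volume := by
  have hc : Continuous fun x : ℝ => Real.exp (|t * x| - x ^ 2) := by fun_prop
  rw [memLp_two_iff_integrable_sq hc.aestronglyMeasurable]
  refine ((integrable_exp_neg_mul_sq (b := 1) (by norm_num)).const_mul
    (Real.exp (t ^ 2))).mono' (hc.pow 2).aestronglyMeasurable (Eventually.of_forall fun x => ?_)
  rw [Real.norm_of_nonneg (by positivity), ← Real.exp_nat_mul, ← Real.exp_add]
  refine Real.exp_le_exp.2 ?_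
  push_cast
  rw [abs_mul]
  nlinarith [sq_nonneg (|t| - |x|), sq_abs t, sq_abs x]

theorem memLp_poly (p : ℝ[X]) :
    MemLp (fun x : ℝ => ((p.eval (2 * x) * Real.exp (-x ^ 2) : ℝ) : ℂ)) 2 volume := by
  have hc : Continuous fun x : ℝ => ((p.eval (2 * x) * Real.exp (-x ^ 2) : ℝ) : ℂ) := by fun_prop
  rw [memLp_two_iff_integrable_sq_norm hc.aestronglyMeasurable]
  refine (integrable_poly_gauss ((p * p).comp (C 2 * X)) (b := 2) (by norm_num)).congr
    (Eventually.of_forall fun x => ?_)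
  have : Real.exp (-2 * x ^ 2) = Real.exp (-x ^ 2) * Real.exp (-x ^ 2) := by
    rw [← Real.exp_add]; congr 1; ring
  simp only [eval_comp, eval_mul, eval_C, eval_X, Complex.norm_real, Real.norm_eq_abs, sq_abs, this]
  ring

theorem numberL2_complete :
    (Submodule.span ℂ (Set.range numberL2))ᗮ = ⊥ := by
  rw [Submodule.eq_bot_iff]
  intro g hg
  have hgi : ∀ F : ℝ → ℂ, MemLp F 2 volume → Integrable fun x => F x * g x := fun F hF =>
    hF.integrable_mul (Lp.memLp g)
  let Λ : ℝ[X] → ℂ := fun p => ∫ x : ℝ, ((p.eval (2 * x) * Real.exp (-x ^ 2) : ℝ) : ℂ) * g x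
  have hΛadd : ∀ p q, Λ (p + q) = Λ p + Λ q := by
    intro p q
    simp only [Λ]
    rw [← integral_add (hgi _ (memLp_poly p)) (hgi _ (memLp_poly q))]
    refine integral_congr_ae (Eventually.of_forall fun x => ?_)
    simp only [eval_add]; push_cast; ring
  have hΛC : ∀ (c : ℝ) p, Λ (C c * p) = c * Λ p := by
    intro c p
    simp only [Λ]
    rw [← integral_const_mul]
    refine integral_congr_ae (Eventually.of_forall fun x => ?_)
    simp only [eval_mul, eval_C]; push_cast; ring
  have hΛh : ∀ n, Λ (hermiteR n) = 0 := by
    intro n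
    have h1 : inner ℂ (numberL2 n) g = 0 :=
      (Submodule.mem_orthogonal _ _).1 hg _ (Submodule.subset_span ⟨n, rfl⟩)
    rw [L2.inner_def] at h1
    have h2 : ∫ x : ℝ, inner ℂ (numberL2 n x) (g x) =
        ∫ x : ℝ, ((√(√(2 / Real.pi) / (n.factorial : ℝ)) : ℝ) : ℂ) *
          (((hermiteR n).eval (2 * x) * Real.exp (-x ^ 2) : ℝ) * g x) := by
      refine integral_congr_ae ?_
      filter_upwards [(memLp_numberFn n).coeFn_toLp] with x hn
      simp only [numberL2, hn, RCLike.inner_apply, Complex.conj_ofReal]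
      simp only [numberFn]; push_cast; ring
    rw [h2, integral_const_mul] at h1
    rcases mul_eq_zero.1 h1 with h | h
    · exfalso
      have : 0 < √(√(2 / Real.pi) / (n.factorial : ℝ)) := by positivity
      exact this.ne' (by exact_mod_cast h)
    · exact h
  have hΛX : ∀ k n, Λ (X ^ k * hermiteR n) = 0 := by
    intro k
    induction k with
    | zero => intro n; simpa using hΛh n
    | succ k ih =>
      intro n
      cases n with
      | zero =>
        have : X ^ (k + 1) * hermiteR 0 = X ^ k * hermiteR 1 := by
          rw [hermiteR_succ, hermiteR_zero]; simp [pow_succ]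
        rw [this, ih]
      | succ n =>
        have : X ^ (k + 1) * hermiteR (n + 1) =
            X ^ k * hermiteR (n + 2) + C ((n : ℝ) + 1) * (X ^ k * hermiteR n) := by
          rw [pow_succ, mul_assoc, hermiteR_recurrence]; simp; ring
        rw [this, hΛadd, hΛC, ih, ih]; simp
  have hmono : ∀ k : ℕ, ∫ x : ℝ, ((2 * x : ℝ) : ℂ) ^ k * (Real.exp (-x ^ 2) * g x) = 0 := by
    intro k
    have := hΛX k 0
    rw [hermiteR_zero, mul_one] at this
    rw [← this]
    refine integral_congr_ae (Eventually.of_forall fun x => ?_)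
    simp only [eval_pow, eval_X]; push_cast; ring
  have hzero : (fun x : ℝ => (Real.exp (-x ^ 2) : ℂ) * g x) =ᵐ[volume] 0 := by
    refine ae_zero_of_fourier_zero ?_ ?_
    · have := hgi _ (memLp_poly 1)
      simpa using this
    · intro t
      have hs := hasSum_integral_of_dominated_convergence (μ := volume)
        (F := fun (k : ℕ) (x : ℝ) => (t * x * Complex.I) ^ k / (k.factorial : ℂ) *
          ((Real.exp (-x ^ 2) : ℂ) * g x))
        (f := fun x : ℝ => Complex.exp (t * x * Complex.I) * ((Real.exp (-x ^ 2) : ℂ) * g x))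
        (fun k x => |t * x| ^ k / (k.factorial : ℝ) * (Real.exp (-x ^ 2) * ‖g x‖)) ?_ ?_ ?_ ?_ ?_
      · refine hs.unique ?_
        convert hasSum_zero with k
        have : ∀ x : ℝ, (t * x * Complex.I) ^ k / (k.factorial : ℂ) * ((Real.exp (-x ^ 2) : ℂ) * g x) =
            ((t * Complex.I / 2) ^ k / (k.factorial : ℂ)) *
              (((2 * x : ℝ) : ℂ) ^ k * (Real.exp (-x ^ 2) * g x)) := by
          intro x
          have : (t * x * Complex.I : ℂ) = (t * Complex.I / 2) * ((2 * x : ℝ) : ℂ) := by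
            push_cast; ring
          rw [this, mul_pow]; ring
        simp_rw [this]
        rw [integral_const_mul, hmono, mul_zero]
      · intro k
        refine AEStronglyMeasurable.mul ?_ (AEStronglyMeasurable.mul ?_ (Lp.aestronglyMeasurable g))
        · exact Continuous.aestronglyMeasurable (by fun_prop)
        · exact Continuous.aestronglyMeasurable (by fun_prop)
      · intro k
        refine Eventually.of_forall fun x => le_of_eq ?_
        simp only [norm_mul, norm_div, norm_pow, Complex.norm_real, Complex.norm_I, mul_one,
          Complex.norm_natCast, Real.norm_eq_abs, abs_mul, abs_of_pos (Real.exp_pos _)]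
      · refine Eventually.of_forall fun x => ?_
        exact (Real.summable_pow_div_factorial _).mul_right _
      · have h1 := ((memLp_exp t).integrable_mul (Lp.memLp g).norm)
        refine h1.congr (Eventually.of_forall fun x => ?_)
        have h2 : HasSum (fun k : ℕ => |t * x| ^ k / (k.factorial : ℝ)) (Real.exp |t * x|) := by
          rw [Real.exp_eq_exp_ℝ]; exact NormedSpace.expSeries_div_hasSum_exp _
        have h3 := (h2.mul_right (Real.exp (-x ^ 2) * ‖g x‖)).tsum_eq
        simp only [Pi.mul_apply]
        rw [h3, sub_eq_add_neg, Real.exp_add]; ring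
      · refine Eventually.of_forall fun x => ?_
        have h2 : HasSum (fun k : ℕ => (t * x * Complex.I : ℂ) ^ k / (k.factorial : ℂ))
            (Complex.exp (t * x * Complex.I)) := by
          rw [Complex.exp_eq_exp_ℂ]; exact NormedSpace.expSeries_div_hasSum_exp _
        exact h2.mul_right _
  rw [Lp.eq_zero_iff_ae_eq_zero]
  filter_upwards [hzero] with x hx
  have : (Real.exp (-x ^ 2) : ℂ) ≠ 0 := by exact_mod_cast (Real.exp_pos _).ne'
  simpa [this] using hx

theorem orthonormal_phase (φ : ℝ) : Orthonormal ℂ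
    fun n : ℕ => Complex.exp (-(n * φ) * Complex.I) • numberL2 n := by
  have h := orthonormal_iff_ite.1 orthonormal_numberL2
  rw [orthonormal_iff_ite]
  intro n m
  rw [inner_smul_left, inner_smul_right, h]
  split_ifs with hnm
  · subst hnm
    rw [mul_one, mul_comm, Complex.mul_conj, Complex.normSq_eq_norm_sq]
    have : (-(n * φ) * Complex.I : ℂ) = ((-(n * φ) : ℝ) : ℂ) * Complex.I := by push_cast; ring
    rw [this, Complex.norm_exp_ofReal_mul_I]; simp
  · simp

theorem complete_phase (φ : ℝ) : (Submodule.span ℂ (Set.range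
    fun n : ℕ => Complex.exp (-(n * φ) * Complex.I) • numberL2 n))ᗮ = ⊥ := by
  rw [eq_bot_iff, ← numberL2_complete]
  refine Submodule.orthogonal_le (Submodule.span_le.2 ?_)
  rintro _ ⟨n, rfl⟩
  have h : Complex.exp (-(n * φ) * Complex.I) • numberL2 n ∈ Submodule.span ℂ (Set.range
      fun n : ℕ => Complex.exp (-(n * φ) * Complex.I) • numberL2 n) :=
    Submodule.subset_span ⟨n, rfl⟩
  have h2 := Submodule.smul_mem _ (Complex.exp (-(n * φ) * Complex.I))⁻¹ h
  rwa [smul_smul, inv_mul_cancel₀ (Complex.exp_ne_zero _), one_smul] at h2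

/-! ### The oscillator, its quadratures and their spectral representation -/

/-- The Hilbert space of the harmonic oscillator, `ℓ²(ℕ)` in the number basis `|0⟩, |1⟩, …`. -/
abbrev Fock : Type := lp (fun _ : ℕ => ℂ) 2

/-- The wave functions `e^{-inφ} u_n(x) = ₍φ₎⟨x|n⟩` of the number states in the eigenrepresentation
of the quadrature `X_φ`; they form a Hilbert basis of `L²(ℝ)`. -/
def quadratureBasis (φ : ℝ) : HilbertBasis ℕ ℂ (Lp ℂ 2 (volume : Measure ℝ)) :=
  HilbertBasis.mkOfOrthogonalEqBot (orthonormal_phase φ) (complete_phase φ)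

/-- The unitary spectral representation of `X_φ`: it sends `|n⟩` to `e^{-inφ} u_n` and turns `X_φ`
into multiplication by `x` (see `quadratureRep_quadrature`). -/
def quadratureRep (φ : ℝ) : Fock ≃ₗᵢ[ℂ] Lp ℂ 2 (volume : Measure ℝ) :=
  (quadratureBasis φ).repr.symm

/-- The annihilation operator `a|n⟩ = √n |n-1⟩` on finite superpositions of number states. -/
def annihilation : (ℕ →₀ ℂ) →ₗ[ℂ] (ℕ →₀ ℂ) :=
  Finsupp.linearCombination ℂ fun n : ℕ => Finsupp.single (n - 1) (√(n : ℝ) : ℂ)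

/-- The creation operator `a†|n⟩ = √(n+1) |n+1⟩` on finite superpositions of number states. -/
def creation : (ℕ →₀ ℂ) →ₗ[ℂ] (ℕ →₀ ℂ) :=
  Finsupp.linearCombination ℂ fun n : ℕ => Finsupp.single (n + 1) (√((n : ℝ) + 1) : ℂ)

/-- The quadrature `X_φ = (a† e^{iφ} + a e^{-iφ}) / 2` on finite superpositions of number states. -/
def quadrature (φ : ℝ) : (ℕ →₀ ℂ) →ₗ[ℂ] (ℕ →₀ ℂ) :=
  (1 / 2 : ℂ) • (Complex.exp (φ * Complex.I) • creation +
    Complex.exp (-φ * Complex.I) • annihilation)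

/-- Finite superpositions of number states as vectors of the Hilbert space. -/
def toFock : (ℕ →₀ ℂ) →ₗ[ℂ] Fock :=
  Finsupp.linearCombination ℂ fun n : ℕ => (lp.single 2 n (1 : ℂ) : Fock)

theorem numberFn_recurrence (n : ℕ) (x : ℝ) : 2 * x * numberFn n x =
    √((n : ℝ) + 1) * numberFn (n + 1) x + √(n : ℝ) * numberFn (n - 1) x := by
  have hs : ∀ m : ℕ, √(√(2 / Real.pi) / (m.factorial : ℝ)) =
      √((m : ℝ) + 1) * √(√(2 / Real.pi) / ((m + 1).factorial : ℝ)) := by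
    intro m
    rw [← Real.sqrt_mul (by positivity), Nat.factorial_succ]
    congr 1
    push_cast
    field_simp
  cases n with
  | zero =>
    simp only [numberFn, hs 0, hermiteR_succ, hermiteR_zero]
    simp; ring
  | succ n =>
    have h := congrArg (eval (2 * x)) (hermiteR_recurrence n)
    simp only [eval_mul, eval_X, eval_add, eval_natCast, eval_one] at h
    have h1 := hs (n + 1)
    have h0 := hs n
    have hsq : √((n : ℝ) + 1) * √((n : ℝ) + 1) = n + 1 := Real.mul_self_sqrt (by positivity)
    simp only [numberFn, Nat.add_sub_cancel]
    push_cast at h1 ⊢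
    calc 2 * x * (√(√(2 / Real.pi) / ((n + 1).factorial : ℝ)) * (hermiteR (n + 1)).eval (2 * x) *
          Real.exp (-x ^ 2)) = √(√(2 / Real.pi) / ((n + 1).factorial : ℝ)) *
          (2 * x * (hermiteR (n + 1)).eval (2 * x)) * Real.exp (-x ^ 2) := by ring
      _ = _ := by
        rw [h, h0]
        nth_rewrite 1 [mul_add, h1]
        linear_combination (-(√(√(2 / Real.pi) / ((n + 1).factorial : ℝ)) *
          eval (2 * x) (hermiteR n) * Real.exp (-x ^ 2))) * hsq

theorem quadratureRep_single (φ : ℝ) (n : ℕ) (c : ℂ) :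
    quadratureRep φ (toFock (Finsupp.single n c)) =
      (c * Complex.exp (-(n * φ) * Complex.I)) • numberL2 n := by
  simp only [toFock, Finsupp.linearCombination_single, map_smul, quadratureRep]
  rw [HilbertBasis.repr_symm_single]
  simp [quadratureBasis, smul_smul]

/-- `quadratureRep φ` diagonalizes the quadrature `X_φ = (a† e^{iφ} + a e^{-iφ}) / 2`. -/
theorem quadratureRep_quadrature (φ : ℝ) (v : ℕ →₀ ℂ) :
    quadratureRep φ (toFock (quadrature φ v)) =ᵐ[volume]
      fun x : ℝ => (x : ℂ) * quadratureRep φ (toFock v) x := by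
  induction v using Finsupp.induction_linear with
  | zero =>
    simp only [map_zero]
    filter_upwards [Lp.coeFn_zero ℂ 2 (volume : Measure ℝ)] with x hx
    simp
  | add v w hv hw =>
    simp only [map_add]
    filter_upwards [hv, hw, Lp.coeFn_add (quadratureRep φ (toFock (quadrature φ v)))
      (quadratureRep φ (toFock (quadrature φ w))),
      Lp.coeFn_add (quadratureRep φ (toFock v)) (quadratureRep φ (toFock w))] with x h1 h2 h3 h4
    rw [h3, h4, Pi.add_apply, Pi.add_apply, h1, h2, mul_add]
  | single n c =>
    have hq : quadratureRep φ (toFock (quadrature φ (Finsupp.single n c))) =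
        (c * Complex.exp (-(n * φ) * Complex.I) * (1 / 2) * √((n : ℝ) + 1) : ℂ) •
            numberL2 (n + 1) +
          (c * Complex.exp (-(n * φ) * Complex.I) * (1 / 2) * √(n : ℝ) : ℂ) •
            numberL2 (n - 1) := by
      simp only [quadrature, creation, annihilation, LinearMap.smul_apply, LinearMap.add_apply,
        Finsupp.linearCombination_single, map_smul, map_add, quadratureRep_single, smul_smul,
        smul_add]
      congr 2
      · have : Complex.exp (-(n * φ) * Complex.I) = Complex.exp (φ * Complex.I) *
            Complex.exp (-(((n + 1 : ℕ) : ℂ) * φ) * Complex.I) := by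
          rw [← Complex.exp_add]; congr 1; push_cast; ring
        rw [this]; ring
      · cases n with
        | zero => simp
        | succ n =>
          have : Complex.exp (-(((n + 1 : ℕ) : ℂ) * φ) * Complex.I) =
              Complex.exp (-φ * Complex.I) * Complex.exp (-((n : ℂ) * φ) * Complex.I) := by
            rw [← Complex.exp_add]; congr 1; push_cast; ring
          rw [this]; simp only [Nat.add_sub_cancel]; ring
    rw [hq, quadratureRep_single]
    filter_upwards [Lp.coeFn_add ((c * Complex.exp (-(n * φ) * Complex.I) * (1 / 2) *
        √((n : ℝ) + 1) : ℂ) • numberL2 (n + 1)) ((c * Complex.exp (-(n * φ) * Complex.I) *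
        (1 / 2) * √(n : ℝ) : ℂ) • numberL2 (n - 1)),
      Lp.coeFn_smul (c * Complex.exp (-(n * φ) * Complex.I) * (1 / 2) *
        √((n : ℝ) + 1) : ℂ) (numberL2 (n + 1)),
      Lp.coeFn_smul (c * Complex.exp (-(n * φ) * Complex.I) * (1 / 2) *
        √(n : ℝ) : ℂ) (numberL2 (n - 1)),
      Lp.coeFn_smul (c * Complex.exp (-(n * φ) * Complex.I)) (numberL2 n),
      (memLp_numberFn n).coeFn_toLp, (memLp_numberFn (n + 1)).coeFn_toLp,
      (memLp_numberFn (n - 1)).coeFn_toLp] with x h1 h2 h3 h4 h5 h6 h7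
    rw [h1, Pi.add_apply, h2, h3, h4]
    simp only [Pi.smul_apply, smul_eq_mul, numberL2, h5, h6, h7]
    have h := congrArg (fun r : ℝ => (r : ℂ)) (numberFn_recurrence n x)
    push_cast at h
    linear_combination (-(c * Complex.exp (-(n * φ) * Complex.I) * (1 / 2))) * h

/-! ### Ensemble averages of estimators -/

/-- A (generally mixed) state `ρ = ∑ j, |ψ_j⟩⟨ψ_j|` with `Tr ρ = ∑ j, ‖ψ_j‖² = 1`; every density
operator is of this form, and the pure states are those with one nonzero `ψ_j`. -/
structure State where
  /-- The unnormalized vectors of the ensemble. -/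
  vec : ℕ → Fock
  hasSum_norm_sq : HasSum (fun j => ‖vec j‖ ^ 2) 1

/-- The measure `⟨dE_φ(x)⟩ = Tr[ρ dE_φ(x)]`, where `E_φ` is the spectral measure of `X_φ`:
since `quadratureRep φ` turns `X_φ` into multiplication by `x`, one has
`⟨ψ, E_φ(B) ψ⟩ = ∫_B |quadratureRep φ ψ|²`. -/
def State.outcome (ρ : State) (φ : ℝ) : Measure ℝ :=
  Measure.sum fun j : ℕ => (volume : Measure ℝ).withDensity
    fun x => ‖quadratureRep φ (ρ.vec j) x‖ₑ ^ 2

/-- The probability measure `dφ/π` on the quorum `[0, π)`. -/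
def phaseMeasure : Measure ℝ :=
  ENNReal.ofReal (1 / Real.pi) • (volume : Measure ℝ).restrict (Set.Ico 0 Real.pi)

/-- An estimator, possibly containing a distribution (a measure) in the phase variable: a function
`val φ x` of the phase `φ` and of the outcome `x`, together with the measure `weight` on the phases
against which it is averaged, and which is `dφ/π` for an ordinary function. -/
structure Estimator where
  /-- The measure on the phases. -/
  weight : Measure ℝ
  /-- The function of phase and outcome. -/
  val : ℝ → ℝ → ℂ

/-- An ordinary estimator function `n φ x`. -/
def Estimator.ofFun (n : ℝ → ℝ → ℂ) : Estimator := ⟨phaseMeasure, n⟩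

/-- The estimator `n φ x * δ_π(φ)`, `δ_π` being the Dirac delta at `φ = 0` on the interval
`[0, π)`, normalized by `∫_0^π δ_π(φ) dφ = 1`; so `δ_π(φ) dφ/π` is `1/π` times the unit mass. -/
def Estimator.mulDelta (n : ℝ → ℝ → ℂ) : Estimator :=
  ⟨ENNReal.ofReal (1 / Real.pi) • Measure.dirac 0, n⟩

/-- The double average of the estimator over phases and outcomes converges absolutely. -/
def Estimator.Converges (e : Estimator) (ρ : State) : Prop :=
  (∀ᵐ φ ∂e.weight, Integrable (e.val φ) (ρ.outcome φ)) ∧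
  Integrable (fun φ => ∫ x, e.val φ x ∂(ρ.outcome φ)) e.weight ∧
  ∫⁻ φ, ∫⁻ x, ‖e.val φ x‖ₑ ∂(ρ.outcome φ) ∂e.weight < ⊤

/-- The double average `∫ dμ(φ) ∫ ⟨dE_φ(x)⟩ e_φ(x)` in the state `ρ`. -/
def Estimator.mean (e : Estimator) (ρ : State) : ℂ :=
  ∫ φ, ∫ x, e.val φ x ∂(ρ.outcome φ) ∂e.weight

/-- `e ≃ e'` on the states of `S`: both double averages converge absolutely, and that of the
difference vanishes. -/
def Estimator.Equiv (S : Set State) (e e' : Estimator) : Prop :=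
  ∀ ρ ∈ S, e.Converges ρ ∧ e'.Converges ρ ∧ e.mean ρ - e'.mean ρ = 0

/-- `e ε ≃ e'` in the limit `ε → 1⁻`, on the states of `S`. -/
def Estimator.LimEquiv (S : Set State) (e : ℝ → Estimator) (e' : Estimator) : Prop :=
  ∀ ρ ∈ S, (∀ᶠ ε in 𝓝[<] (1 : ℝ), (e ε).Converges ρ) ∧ e'.Converges ρ ∧
    Tendsto (fun ε => (e ε).mean ρ - e'.mean ρ) (𝓝[<] 1) (𝓝 0)

/-- The Poisson form of `δ_π` at regularization `ε < 1`:
`(1/π) ∑_{n ∈ ℤ} ε^|n| e^{2inφ}`. -/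
def poissonDelta (ε φ : ℝ) : ℂ :=
  (1 / Real.pi : ℂ) * ∑' n : ℤ, (ε : ℂ) ^ n.natAbs * Complex.exp (2 * n * φ * Complex.I)

/-- The `k`-th Taylor coefficient of `f` at `0`. -/
def taylorCoeff (f : ℂ → ℂ) (k : ℕ) : ℂ := iteratedDeriv k f 0 / (k.factorial : ℂ)

/-- The averaged moment `∫ dφ/π ⟨X_φ^{2k}⟩`. -/
def State.meanMoment (ρ : State) (k : ℕ) : ℝ≥0∞ :=
  ∫⁻ φ, ∫⁻ x, ‖x‖ₑ ^ (2 * k) ∂(ρ.outcome φ) ∂phaseMeasure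

/-- The states on which the ensemble average of `f(X_φ²)`, `f(z) = ∑ k, a_k z^k` entire, is well
defined through the power series: `∑ k, (k+1) |a_k| ∫ dφ/π ⟨X_φ^{2k}⟩ < ∞`. -/
def domainOf (f : ℂ → ℂ) : Set State :=
  {ρ | ∑' k : ℕ, ((k : ℝ≥0∞) + 1) * ‖taylorCoeff f k‖ₑ * ρ.meanMoment k < ⊤}

end Homodyne

end

/-! The moment `⟨X_φ ^ m⟩` is a trigonometric polynomial in `φ` of degree at most `m`
whose frequencies have the parity of `m`, because the position operator couples only neighbouring
number states. The Dirichlet kernel `∑_{j ≤ m} e^{i(2j-m)φ}`, which off `φ = 0` is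
`e^{imφ} / (1 - e^{-2iφ}) + e^{-imφ} / (1 - e^{2iφ})`, reproduces the value at `0` of such a
polynomial, so summing over the Taylor coefficients of `f` gives the identities; the Poisson kernel
does the same in the limit.

The analytic point is that a finite phase-averaged moment controls the moment at every single phase.
Averaging `⟨X_φ ^ 2k⟩` over `φ` removes the coherences between the number states `n` and `m`: for
odd `n - m` they vanish by the parity of the wave functions `u_n`, for even `n - m ≠ 0` the phase
integrates to zero. So finiteness of the average means `∑ |ψ_n|² ‖x^k u_n‖² < ∞`. Since `x^k u_n`
and `x^k u_m` are orthogonal for `|n - m| > 2k`, the series `∑ ψ_n e^{-inφ} x^k u_n` then converges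
for every `φ`. Its square norm `⟨X_φ ^ 2k⟩` is a polynomial with `2k + 1` frequencies, hence at most
`2k + 1` times its average. -/

noncomputable section

open MeasureTheory Filter Topology Polynomial
open scoped ENNReal ContDiff

namespace Homodyne

/-! ### Trigonometric polynomials -/

/-- The character `φ ↦ e^{inφ}`. -/
def phaseExp (n : ℤ) (φ : ℝ) : ℂ := Complex.exp (n * φ * Complex.I)

theorem phaseExp_mul (m n : ℤ) (φ : ℝ) : phaseExp m φ * phaseExp n φ = phaseExp (m + n) φ := by
  simp only [phaseExp, ← Complex.exp_add, Int.cast_add, add_mul]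

@[simp] theorem phaseExp_zero_left (φ : ℝ) : phaseExp 0 φ = 1 := by simp [phaseExp]

@[simp] theorem phaseExp_zero_right (n : ℤ) : phaseExp n 0 = 1 := by simp [phaseExp]

@[simp] theorem norm_phaseExp (n : ℤ) (φ : ℝ) : ‖phaseExp n φ‖ = 1 := by
  simpa [phaseExp] using Complex.norm_exp_ofReal_mul_I (n * φ)

theorem conj_phaseExp (n : ℤ) (φ : ℝ) : starRingEnd ℂ (phaseExp n φ) = phaseExp (-n) φ := by
  simp [phaseExp, ← Complex.exp_conj]

theorem phaseExp_pow (n : ℤ) (k : ℕ) (φ : ℝ) : phaseExp n φ ^ k = phaseExp (k * n) φ := by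
  simp only [phaseExp, ← Complex.exp_nat_mul, Int.cast_mul, Int.cast_natCast, mul_assoc]

@[fun_prop] theorem continuous_phaseExp (n : ℤ) : Continuous (phaseExp n) := by
  unfold phaseExp; fun_prop

theorem integral_phaseMeasure (g : ℝ → ℂ) :
    ∫ φ, g φ ∂phaseMeasure = (1 / Real.pi : ℂ) * ∫ φ in (0 : ℝ)..Real.pi, g φ := by
  rw [phaseMeasure, integral_smul_measure, intervalIntegral.integral_of_le Real.pi_pos.le,
    integral_Ico_eq_integral_Ioc, ENNReal.toReal_ofReal (by positivity)]
  simp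

instance : IsProbabilityMeasure phaseMeasure where
  measure_univ := by
    simp [phaseMeasure, ← ENNReal.ofReal_mul, Real.pi_pos.le, Real.pi_pos.ne']

theorem ae_phaseMeasure_mem_Ioo : ∀ᵐ φ ∂phaseMeasure, φ ∈ Set.Ioo 0 Real.pi := by
  rw [phaseMeasure, ← restrict_Ioo_eq_restrict_Ico]
  exact Measure.ae_smul_measure (ae_restrict_mem measurableSet_Ioo) _

theorem integrable_phaseMeasure_of_continuous {E : Type*} [NormedAddCommGroup E] {g : ℝ → E}
    (hg : Continuous g) : Integrable g phaseMeasure :=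
  ((hg.continuousOn.integrableOn_compact isCompact_Icc).mono_set
    Set.Ico_subset_Icc_self).smul_measure ENNReal.ofReal_ne_top

theorem integral_phaseExp_two_mul (n : ℤ) :
    ∫ φ, phaseExp (2 * n) φ ∂phaseMeasure = if n = 0 then 1 else 0 := by
  split_ifs with h
  · simp [h]
  · have hc : ((2 * n : ℤ) : ℂ) * Complex.I ≠ 0 := by simp [h]
    have hπ : Complex.exp (((2 * n : ℤ) : ℂ) * Complex.I * Real.pi) = 1 :=
      Complex.exp_eq_one_iff.2 ⟨n, by push_cast; ring⟩
    simp_rw [integral_phaseMeasure, phaseExp, mul_right_comm _ _ Complex.I]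
    rw [integral_exp_mul_complex hc, hπ]
    simp

/-- The trigonometric polynomials of degree at most `m` whose frequencies have the parity
of `m`. -/
def trigSpan (m : ℕ) : Submodule ℂ (ℝ → ℂ) :=
  Submodule.span ℂ ((fun i : ℕ => phaseExp (2 * i - m)) '' Finset.range (m + 1))

theorem isClosed_trigSpan (m : ℕ) : IsClosed (trigSpan m : Set (ℝ → ℂ)) := by
  have : FiniteDimensional ℂ (trigSpan m) :=
    FiniteDimensional.span_of_finite ℂ ((Finset.finite_toSet _).image _)
  exact Submodule.closed_of_finiteDimensional _

theorem phaseExp_mem_trigSpan {m : ℕ} {n : ℤ} (hn : |n| ≤ m) (hp : Even (n + m)) :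
    phaseExp n ∈ trigSpan m := by
  obtain ⟨r, hr⟩ := hp
  rw [abs_le] at hn
  refine Submodule.subset_span ⟨r.toNat, by simp; omega, ?_⟩
  dsimp only
  congr 1
  omega

theorem continuous_of_mem_trigSpan {m : ℕ} {g : ℝ → ℂ} (hg : g ∈ trigSpan m) : Continuous g := by
  induction hg using Submodule.span_induction with
  | mem g hg => obtain ⟨i, -, rfl⟩ := hg; exact continuous_phaseExp _
  | zero => exact continuous_zero
  | add g h _ _ ihg ihh => exact ihg.add ihh
  | smul c g _ ih => exact ih.const_smul c

/-- The Fourier coefficient of `g` at the frequency `n`, averaged over `[0, π)`,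
which is a full period for characters of even frequency only. -/
def phaseCoeff (n : ℤ) (g : ℝ → ℂ) : ℂ := ∫ φ, phaseExp (-n) φ * g φ ∂phaseMeasure

theorem norm_phaseCoeff_le (n : ℤ) (g : ℝ → ℂ) :
    ‖phaseCoeff n g‖ ≤ ∫ φ, ‖g φ‖ ∂phaseMeasure :=
  (norm_integral_le_integral_norm _).trans_eq (by simp)

theorem phaseCoeff_phaseExp (m : ℤ) (i j : ℕ) :
    phaseCoeff (2 * i - m) (phaseExp (2 * j - m)) = if i = j then 1 else 0 := by
  have h (φ : ℝ) : phaseExp (-(2 * i - m)) φ * phaseExp (2 * j - m) φ =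
      phaseExp (2 * (j - i)) φ := by
    rw [phaseExp_mul]; congr 1; ring
  simp only [phaseCoeff, h, integral_phaseExp_two_mul, sub_eq_zero, Nat.cast_inj, eq_comm]

theorem sum_phaseCoeff_mul_phaseExp {m : ℕ} {g : ℝ → ℂ} (hg : g ∈ trigSpan m) (φ : ℝ) :
    ∑ i ∈ Finset.range (m + 1), phaseCoeff (2 * i - m) g * phaseExp (2 * i - m) φ = g φ := by
  induction hg using Submodule.span_induction with
  | mem g hg =>
    obtain ⟨j, hj, rfl⟩ := hg
    simpa [phaseCoeff_phaseExp] using fun h => absurd (Finset.mem_range.1 hj) (by omega)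
  | zero => simp [phaseCoeff]
  | add g h hg hh ihg ihh =>
    have hadd (n : ℤ) : phaseCoeff n (g + h) = phaseCoeff n g + phaseCoeff n h := by
      simp only [phaseCoeff, Pi.add_apply, mul_add]
      exact integral_add
        (integrable_phaseMeasure_of_continuous
          ((continuous_phaseExp _).mul (continuous_of_mem_trigSpan hg)))
        (integrable_phaseMeasure_of_continuous
          ((continuous_phaseExp _).mul (continuous_of_mem_trigSpan hh)))
    simp only [hadd, add_mul, Finset.sum_add_distrib, ihg, ihh, Pi.add_apply]
  | smul c g _ ih =>
    have hsmul (n : ℤ) : phaseCoeff n (c • g) = c * phaseCoeff n g := by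
      simp only [phaseCoeff, Pi.smul_apply, smul_eq_mul, mul_left_comm _ c, integral_const_mul]
    simp only [hsmul, mul_assoc, ← Finset.mul_sum, ih, Pi.smul_apply, smul_eq_mul]

theorem norm_le_of_mem_trigSpan {m : ℕ} {g : ℝ → ℂ} (hg : g ∈ trigSpan m) (θ : ℝ) :
    ‖g θ‖ ≤ (m + 1) * ∫ φ, ‖g φ‖ ∂phaseMeasure := by
  rw [← sum_phaseCoeff_mul_phaseExp hg θ]
  have hterm (i : ℕ) : ‖phaseCoeff (2 * i - m) g * phaseExp (2 * i - m) θ‖ ≤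
      ∫ φ, ‖g φ‖ ∂phaseMeasure := by
    simpa using norm_phaseCoeff_le _ g
  simpa using norm_sum_le_of_le (Finset.range (m + 1)) fun i _ => hterm i

/-! ### The Dirichlet and Poisson kernels -/

/-- The Dirichlet kernel `∑_{i ≤ m} e^{i(2i-m)φ}` of `trigSpan m`. -/
def dirichletKernel (m : ℕ) (φ : ℝ) : ℂ := ∑ i ∈ Finset.range (m + 1), phaseExp (2 * i - m) φ

theorem dirichletKernel_zero (φ : ℝ) : dirichletKernel 0 φ = 1 := by simp [dirichletKernel]

@[fun_prop] theorem continuous_dirichletKernel (m : ℕ) : Continuous (dirichletKernel m) := by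
  unfold dirichletKernel; fun_prop

theorem enorm_phaseExp (n : ℤ) (φ : ℝ) : ‖phaseExp n φ‖ₑ = 1 := by
  rw [← ofReal_norm, norm_phaseExp, ENNReal.ofReal_one]

theorem enorm_dirichletKernel_le (m : ℕ) (φ : ℝ) : ‖dirichletKernel m φ‖ₑ ≤ m + 1 :=
  (enorm_sum_le _ _).trans_eq (by simp [enorm_phaseExp])

theorem dirichletKernel_eq_sum_neg (m : ℕ) (φ : ℝ) :
    dirichletKernel m φ = ∑ i ∈ Finset.range (m + 1), phaseExp (-(2 * i - m)) φ := by
  rw [dirichletKernel, ← Finset.sum_range_reflect]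
  refine Finset.sum_congr rfl fun i hi => ?_
  have := Finset.mem_range.1 hi
  congr 1
  omega

theorem integral_dirichletKernel_mul {m : ℕ} {g : ℝ → ℂ} (hg : g ∈ trigSpan m) :
    ∫ φ, dirichletKernel m φ * g φ ∂phaseMeasure = g 0 := by
  have hc := continuous_of_mem_trigSpan hg
  simp_rw [dirichletKernel_eq_sum_neg, Finset.sum_mul]
  rw [integral_finsetSum _ fun i _ => integrable_phaseMeasure_of_continuous (by fun_prop),
    ← sum_phaseCoeff_mul_phaseExp hg 0]
  simp only [phaseExp_zero_right, mul_one, phaseCoeff]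

theorem phaseExp_two_ne_one {φ : ℝ} (hφ : φ ∈ Set.Ioo 0 Real.pi) : phaseExp 2 φ ≠ 1 := by
  intro h
  have hcos : Real.cos (2 * φ) = 1 := by
    rw [← Complex.exp_ofReal_mul_I_re]
    simpa [phaseExp] using congrArg Complex.re h
  have hsin := Real.sin_pos_of_mem_Ioo hφ
  rw [Real.cos_two_mul, Real.cos_sq'] at hcos
  nlinarith

theorem dirichletKernel_eq_div {φ : ℝ} (hφ : φ ∈ Set.Ioo 0 Real.pi) (m : ℕ) :
    dirichletKernel m φ = phaseExp m φ / (1 - phaseExp (-2) φ) +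
      phaseExp (-m) φ / (1 - phaseExp 2 φ) := by
  have hsum : dirichletKernel m φ =
      phaseExp (-m) φ * ((phaseExp 2 φ ^ (m + 1) - 1) / (phaseExp 2 φ - 1)) := by
    rw [← geom_sum_eq (phaseExp_two_ne_one hφ), Finset.mul_sum, dirichletKernel]
    refine Finset.sum_congr rfl fun i _ => ?_
    rw [phaseExp_pow, phaseExp_mul]
    congr 1
    ring
  have hpow : phaseExp (-m) φ * phaseExp 2 φ ^ (m + 1) = phaseExp m φ * phaseExp 2 φ := by
    rw [phaseExp_pow, phaseExp_mul, phaseExp_mul]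
    congr 1
    push_cast
    ring
  have hinv : phaseExp 2 φ * phaseExp (-2) φ = 1 := by simp [phaseExp_mul]
  have h₂ : phaseExp 2 φ - 1 ≠ 0 := sub_ne_zero.2 (phaseExp_two_ne_one hφ)
  have h₃ : 1 - phaseExp 2 φ ≠ 0 := sub_ne_zero.2 (phaseExp_two_ne_one hφ).symm
  have h₁ : 1 - phaseExp (-2) φ = (phaseExp 2 φ - 1) / phaseExp 2 φ := by
    rw [eq_div_iff (left_ne_zero_of_mul_eq_one hinv)]
    linear_combination -hinv
  rw [hsum, h₁]
  field_simp
  linear_combination (1 - phaseExp 2 φ) * hpow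

theorem summable_pow_natAbs {r : ℝ} (h0 : 0 ≤ r) (h1 : r < 1) :
    Summable fun n : ℤ => r ^ n.natAbs := by
  refine Summable.of_nat_of_neg ?_ ?_ <;> simpa using summable_geometric_of_lt_one h0 h1

/-- The Poisson kernel `∑ n, ε^|n| e^{2inφ}`. -/
def poissonKernel (ε φ : ℝ) : ℂ := ∑' n : ℤ, (ε : ℂ) ^ n.natAbs * phaseExp (2 * n) φ

theorem poissonDelta_eq (ε φ : ℝ) : poissonDelta ε φ = (1 / Real.pi : ℂ) * poissonKernel ε φ := by
  simp [poissonDelta, poissonKernel, phaseExp]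

section Poisson

variable {ε : ℝ} (h0 : 0 ≤ ε) (h1 : ε < 1)
include h0

theorem norm_pow_mul_phaseExp (k : ℕ) (n : ℤ) (φ : ℝ) :
    ‖(ε : ℂ) ^ k * phaseExp n φ‖ = ε ^ k := by
  simp [abs_of_nonneg h0]

include h1

theorem continuous_poissonKernel : Continuous (poissonKernel ε) :=
  continuous_tsum (fun _ => by fun_prop) (summable_pow_natAbs h0 h1)
    fun _ φ => (norm_pow_mul_phaseExp h0 _ _ φ).le

theorem norm_poissonKernel_le (φ : ℝ) : ‖poissonKernel ε φ‖ ≤ ∑' n : ℤ, ε ^ n.natAbs :=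
  tsum_of_norm_bounded (summable_pow_natAbs h0 h1).hasSum
    fun _ => (norm_pow_mul_phaseExp h0 _ _ φ).le

theorem integral_poissonKernel_mul_phaseExp (j : ℤ) :
    ∫ φ, poissonKernel ε φ * phaseExp (2 * j) φ ∂phaseMeasure = (ε : ℂ) ^ j.natAbs := by
  have hmul (n : ℤ) (φ : ℝ) : (ε : ℂ) ^ n.natAbs * phaseExp (2 * n) φ * phaseExp (2 * j) φ =
      (ε : ℂ) ^ n.natAbs * phaseExp (2 * (n + j)) φ := by
    rw [mul_assoc, phaseExp_mul, mul_add]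
  have hs := hasSum_integral_of_summable_integral_norm (μ := phaseMeasure)
    (F := fun (n : ℤ) φ => (ε : ℂ) ^ n.natAbs * phaseExp (2 * (n + j)) φ)
    (fun _ => integrable_phaseMeasure_of_continuous (by fun_prop)) (by
      simpa only [norm_pow_mul_phaseExp h0, integral_const, probReal_univ, one_smul] using
        summable_pow_natAbs h0 h1)
  simp_rw [poissonKernel, ← tsum_mul_right, hmul]
  refine hs.unique ?_
  have hint (n : ℤ) : ∫ φ, (ε : ℂ) ^ n.natAbs * phaseExp (2 * (n + j)) φ ∂phaseMeasure =
      if n = -j then (ε : ℂ) ^ j.natAbs else 0 := by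
    rw [integral_const_mul, integral_phaseExp_two_mul]
    by_cases hn : n = -j
    · simp [hn]
    · rw [if_neg (by omega), if_neg hn, mul_zero]
  simp_rw [hint]
  exact hasSum_ite_eq _ _

theorem integral_poissonKernel_mul_of_mem_trigSpan {k s : ℕ} {g : ℝ → ℂ}
    (hg : g ∈ trigSpan (2 * k + s)) :
    ∫ φ, phaseExp s φ * poissonKernel ε φ * g φ ∂phaseMeasure =
      ∑ i ∈ Finset.range (2 * k + s + 1),
        phaseCoeff (2 * i - (2 * k + s : ℕ)) g * (ε : ℂ) ^ ((i : ℤ) - k).natAbs := by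
  have hc := continuous_poissonKernel h0 h1
  have h (φ : ℝ) : phaseExp s φ * poissonKernel ε φ * g φ =
      ∑ i ∈ Finset.range (2 * k + s + 1), phaseCoeff (2 * i - (2 * k + s : ℕ)) g *
        (poissonKernel ε φ * phaseExp (2 * (i - k)) φ) := by
    rw [← sum_phaseCoeff_mul_phaseExp hg φ, Finset.mul_sum]
    refine Finset.sum_congr rfl fun i _ => ?_
    have : phaseExp (2 * (i - k)) φ = phaseExp s φ * phaseExp (2 * i - (2 * k + s : ℕ)) φ := by
      rw [phaseExp_mul]; congr 1; push_cast; ring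
    rw [this]
    ring
  simp_rw [h]
  rw [integral_finsetSum _ fun i _ => integrable_phaseMeasure_of_continuous (by fun_prop)]
  simp_rw [integral_const_mul, integral_poissonKernel_mul_phaseExp h0 h1]

theorem norm_integral_poissonKernel_mul_le {k s : ℕ} {g : ℝ → ℂ} (hg : g ∈ trigSpan (2 * k + s)) :
    ‖∫ φ, phaseExp s φ * poissonKernel ε φ * g φ ∂phaseMeasure‖ ≤
      ((2 * k + s : ℕ) + 1) * ∫ φ, ‖g φ‖ ∂phaseMeasure := by
  rw [integral_poissonKernel_mul_of_mem_trigSpan h0 h1 hg]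
  have hterm (i : ℕ) : ‖phaseCoeff (2 * i - (2 * k + s : ℕ)) g *
      (ε : ℂ) ^ ((i : ℤ) - k).natAbs‖ ≤ ∫ φ, ‖g φ‖ ∂phaseMeasure := by
    rw [norm_mul, norm_pow, Complex.norm_real, Real.norm_of_nonneg h0]
    exact (mul_le_of_le_one_right (norm_nonneg _) (pow_le_one₀ h0 h1.le)).trans
      (norm_phaseCoeff_le _ g)
  simpa using norm_sum_le_of_le (Finset.range (2 * k + s + 1)) fun i _ => hterm i

end Poisson

theorem tendsto_integral_poissonKernel_mul {k s : ℕ} {g : ℝ → ℂ} (hg : g ∈ trigSpan (2 * k + s)) :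
    Tendsto (fun ε => ∫ φ, phaseExp s φ * poissonKernel ε φ * g φ ∂phaseMeasure) (𝓝[<] 1)
      (𝓝 (g 0)) := by
  have hlim : Tendsto (fun ε : ℝ => ∑ i ∈ Finset.range (2 * k + s + 1),
      phaseCoeff (2 * i - (2 * k + s : ℕ)) g * (ε : ℂ) ^ ((i : ℤ) - k).natAbs) (𝓝[<] 1)
      (𝓝 (g 0)) := by
    refine (Continuous.tendsto' (by fun_prop) 1 _ ?_).mono_left nhdsWithin_le_nhds
    simp [← sum_phaseCoeff_mul_phaseExp hg 0]
  refine hlim.congr' ?_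
  filter_upwards [Ioo_mem_nhdsLT (show (0 : ℝ) < 1 by norm_num)] with ε hε
  exact (integral_poissonKernel_mul_of_mem_trigSpan hε.1.le hε.2 hg).symm

/-! ### The outcome distributions as a Markov kernel -/

theorem enorm_sq_eq_lintegral {α E : Type*} {_ : MeasurableSpace α} [NormedAddCommGroup E]
    {μ : Measure α} (f : Lp E 2 μ) : ‖f‖ₑ ^ 2 = ∫⁻ x, ‖f x‖ₑ ^ 2 ∂μ := by
  simpa [Lp.enorm_def] using eLpNorm_nnreal_pow_eq_lintegral (p := 2) (f := f) two_ne_zero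

theorem hasSum_quadratureRep (φ : ℝ) (ψ : Fock) :
    HasSum (fun n : ℕ => (ψ n * phaseExp (-n) φ) • numberL2 n) (quadratureRep φ ψ) := by
  refine ((quadratureBasis φ).hasSum_repr_symm ψ).congr_fun fun n => ?_
  simp [quadratureBasis, smul_smul, phaseExp]

/-- The restriction of a wave function to a set of outcomes. -/
abbrev restrictL2 (B : Set ℝ) :
    Lp ℂ 2 (volume : Measure ℝ) →L[ℂ] Lp ℂ 2 ((volume : Measure ℝ).restrict B) :=
  LpToLpRestrictCLM ℝ ℂ ℂ volume 2 B

theorem enorm_restrictL2_sq {B : Set ℝ} (f : Lp ℂ 2 (volume : Measure ℝ)) :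
    ‖restrictL2 B f‖ₑ ^ 2 = ∫⁻ x in B, ‖f x‖ₑ ^ 2 := by
  rw [enorm_sq_eq_lintegral]
  refine lintegral_congr_ae ?_
  filter_upwards [LpToLpRestrictCLM_coeFn ℂ B f] with x hx
  rw [hx]

/-- The distribution of the outcomes of `X_φ` in the pure state `ψ`. -/
def vecOutcome (ψ : Fock) (φ : ℝ) : Measure ℝ :=
  (volume : Measure ℝ).withDensity fun x => ‖quadratureRep φ ψ x‖ₑ ^ 2

theorem vecOutcome_apply (ψ : Fock) (φ : ℝ) {B : Set ℝ} (hB : MeasurableSet B) :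
    vecOutcome ψ φ B = ‖restrictL2 B (quadratureRep φ ψ)‖ₑ ^ 2 := by
  rw [vecOutcome, withDensity_apply _ hB, enorm_restrictL2_sq]

theorem vecOutcome_univ (ψ : Fock) (φ : ℝ) : vecOutcome ψ φ Set.univ = ‖ψ‖ₑ ^ 2 := by
  rw [vecOutcome, withDensity_apply _ MeasurableSet.univ, Measure.restrict_univ,
    ← enorm_sq_eq_lintegral, LinearIsometryEquiv.enorm_map]

theorem tendsto_enorm_sq_restrictL2 (B : Set ℝ) (φ : ℝ) (ψ : Fock) :
    Tendsto (fun N => ‖∑ n ∈ Finset.range N,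
      (ψ n * phaseExp (-n) φ) • restrictL2 B (numberL2 n)‖ₑ ^ 2) atTop
      (𝓝 (‖restrictL2 B (quadratureRep φ ψ)‖ₑ ^ 2)) := by
  have h := (restrictL2 B).hasSum (hasSum_quadratureRep φ ψ)
  simp only [map_smul] at h
  exact ((ENNReal.continuous_pow 2).comp continuous_enorm).continuousAt.tendsto.comp
    h.tendsto_sum_nat

theorem measurable_enorm_sq_sum_phaseExp_smul {E : Type*} [NormedAddCommGroup E] [NormedSpace ℂ E]
    (c : ℕ → ℂ) (v : ℕ → E) (t : Finset ℕ) :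
    Measurable fun φ => ‖∑ n ∈ t, (c n * phaseExp (-n) φ) • v n‖ₑ ^ 2 :=
  ((ENNReal.continuous_pow 2).comp (continuous_enorm.comp (by fun_prop))).measurable

theorem measurable_vecOutcome (ψ : Fock) : Measurable (vecOutcome ψ) := by
  refine Measure.measurable_of_measurable_coe _ fun B hB => ?_
  simp_rw [vecOutcome_apply ψ _ hB]
  exact measurable_of_tendsto_metrizable
    (fun N => measurable_enorm_sq_sum_phaseExp_smul _ _ (Finset.range N))
    (tendsto_pi_nhds.2 fun φ => tendsto_enorm_sq_restrictL2 B φ ψ)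

namespace State

theorem outcome_eq_sum (ρ : State) (φ : ℝ) :
    ρ.outcome φ = Measure.sum fun j => vecOutcome (ρ.vec j) φ := rfl

theorem tsum_enorm_sq (ρ : State) : ∑' j, ‖ρ.vec j‖ₑ ^ 2 = 1 := by
  have h := ENNReal.ofReal_tsum_of_nonneg (fun j => sq_nonneg ‖ρ.vec j‖) ρ.hasSum_norm_sq.summable
  simpa [ρ.hasSum_norm_sq.tsum_eq, ENNReal.ofReal_pow] using h.symm

/-- The outcome distributions of the state `ρ` as a kernel from phases to outcomes. -/
def kernel (ρ : State) : ProbabilityTheory.Kernel ℝ ℝ where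
  toFun := ρ.outcome
  measurable' := by
    refine Measure.measurable_of_measurable_coe _ fun B hB => ?_
    simp_rw [outcome_eq_sum, Measure.sum_apply _ hB]
    exact Measurable.tsum fun j => (Measure.measurable_coe hB).comp (measurable_vecOutcome _)

instance (ρ : State) (φ : ℝ) : IsProbabilityMeasure (ρ.outcome φ) where
  measure_univ := by
    simp_rw [outcome_eq_sum, Measure.sum_apply _ MeasurableSet.univ, vecOutcome_univ,
      ρ.tsum_enorm_sq]

instance (ρ : State) : ProbabilityTheory.IsMarkovKernel ρ.kernel :=
  ⟨fun φ => inferInstanceAs (IsProbabilityMeasure (ρ.outcome φ))⟩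

end State

/-! ### The phase average of the outcome distributions -/

theorem integral_eq_zero_of_odd {G E : Type*} [MeasurableSpace G] [AddGroup G] [MeasurableNeg G]
    [NormedAddCommGroup E] [NormedSpace ℝ E] {μ : Measure G} [μ.IsNegInvariant] {f : G → E}
    (hf : Function.Odd f) : ∫ x, f x ∂μ = 0 := by
  have : IsAddTorsionFree E := .of_isTorsionFree ℝ E
  have h := integral_neg_eq_self f μ
  simp_rw [hf.eq, integral_neg] at h
  exact self_eq_neg.1 h.symm

theorem eval_neg_hermiteR (n : ℕ) (x : ℝ) :
    (hermiteR n).eval (-x) = (-1) ^ n * (hermiteR n).eval x := by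
  induction n using Nat.twoStepInduction with
  | zero => simp [hermiteR_zero]
  | one => simp [hermiteR_succ, hermiteR_zero]
  | more n h0 h1 =>
    have key (y : ℝ) : (hermiteR (n + 2)).eval y =
        y * (hermiteR (n + 1)).eval y - (n + 1) * (hermiteR n).eval y := by
      have h := congrArg (eval y) (hermiteR_recurrence n)
      simp only [eval_mul, eval_X, eval_add, eval_natCast, eval_one] at h
      linarith
    rw [key, key, h0, h1]
    ring

theorem numberFn_neg (n : ℕ) (x : ℝ) : numberFn n (-x) = (-1) ^ n * numberFn n x := by
  simp only [numberFn, mul_neg, eval_neg_hermiteR, neg_sq]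
  ring

theorem coeFn_numberL2 (n : ℕ) : numberL2 n =ᵐ[volume] fun x => (numberFn n x : ℂ) :=
  (memLp_numberFn n).coeFn_toLp

theorem inner_restrictL2_numberL2 {B : Set ℝ} (hB : MeasurableSet B) (hs : ∀ x, -x ∈ B ↔ x ∈ B)
    {n m : ℕ} (hnm : Odd (n + m)) :
    inner ℂ (restrictL2 B (numberL2 n)) (restrictL2 B (numberL2 m)) = 0 := by
  have hae : ∀ᵐ x ∂(volume.restrict B), inner ℂ (restrictL2 B (numberL2 n) x)
      (restrictL2 B (numberL2 m) x) = ((numberFn n x * numberFn m x : ℝ) : ℂ) := by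
    filter_upwards [LpToLpRestrictCLM_coeFn ℂ B (numberL2 n),
      LpToLpRestrictCLM_coeFn ℂ B (numberL2 m), ae_restrict_of_ae (coeFn_numberL2 n),
      ae_restrict_of_ae (coeFn_numberL2 m)] with x h₁ h₂ h₃ h₄
    simp [h₁, h₂, h₃, h₄, mul_comm]
  rw [L2.inner_def, integral_congr_ae hae, ← integral_indicator hB]
  refine integral_eq_zero_of_odd fun x => ?_
  by_cases hx : x ∈ B
  · rw [Set.indicator_of_mem hx, Set.indicator_of_mem ((hs x).2 hx), numberFn_neg, numberFn_neg,
      mul_mul_mul_comm, ← pow_add, hnm.neg_one_pow]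
    simp
  · simp [hx, hs]

section PhaseAverage

variable {E : Type*} [NormedAddCommGroup E] [InnerProductSpace ℂ E] {v : ℕ → E}

theorem inner_sum_phaseExp_smul (v w : ℕ → E) (c : ℕ → ℂ) (t : Finset ℕ) (φ : ℝ) :
    inner ℂ (∑ n ∈ t, (c n * phaseExp (-n) φ) • v n) (∑ n ∈ t, (c n * phaseExp (-n) φ) • w n) =
      ∑ n ∈ t, ∑ m ∈ t, starRingEnd ℂ (c n) * c m * inner ℂ (v n) (w m) * phaseExp (n - m) φ := by
  simp only [sum_inner, inner_sum, inner_smul_left, inner_smul_right, map_mul, conj_phaseExp,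
    Finset.mul_sum]
  rw [Finset.sum_comm]
  refine Finset.sum_congr rfl fun n _ => Finset.sum_congr rfl fun m _ => ?_
  rw [show (n - m : ℤ) = - -n + -m by ring, ← phaseExp_mul]
  ring

theorem integral_norm_sq_sum_phaseExp_smul (hv : ∀ n m, Odd (n + m) → inner ℂ (v n) (v m) = 0)
    (c : ℕ → ℂ) (t : Finset ℕ) :
    ∫ φ, ‖∑ n ∈ t, (c n * phaseExp (-n) φ) • v n‖ ^ 2 ∂phaseMeasure =
      ∑ n ∈ t, ‖c n‖ ^ 2 * ‖v n‖ ^ 2 := by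
  have hint (n m : ℕ) : ∫ φ, starRingEnd ℂ (c n) * c m * inner ℂ (v n) (v m) *
      phaseExp (n - m) φ ∂phaseMeasure = if n = m then (‖c n‖ ^ 2 * ‖v n‖ ^ 2 : ℂ) else 0 := by
    rw [integral_const_mul]
    rcases Nat.even_or_odd (n + m) with he | ho
    · obtain ⟨r, hr⟩ : ∃ r : ℤ, (n : ℤ) - m = 2 * r := by
        obtain ⟨q, hq⟩ := he
        exact ⟨q - m, by omega⟩
      have hr0 : r = 0 ↔ n = m := by omega
      simp only [hr, integral_phaseExp_two_mul, hr0]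
      split_ifs with hnm
      · subst hnm
        rw [inner_self_eq_norm_sq_to_K, Complex.conj_mul', mul_one]
        rfl
      · rw [mul_zero]
    · rw [hv n m ho, if_neg (by rintro rfl; exact Nat.not_odd_iff_even.2 ⟨n, rfl⟩ ho)]
      simp
  have hexpand (φ : ℝ) := (inner_self_eq_norm_sq_to_K (𝕜 := ℂ) _).symm.trans
    (inner_sum_phaseExp_smul v v c t φ)
  rw [← Complex.ofReal_inj, ← integral_complex_ofReal]
  simp only [Complex.coe_algebraMap, ← Complex.ofReal_pow] at hexpand
  simp_rw [hexpand]
  rw [integral_finsetSum _ fun i _ => integrable_phaseMeasure_of_continuous (by fun_prop)]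
  push_cast
  refine Finset.sum_congr rfl fun n hn => ?_
  rw [integral_finsetSum _ fun i _ => integrable_phaseMeasure_of_continuous (by fun_prop)]
  simp [hint, hn]

theorem lintegral_enorm_sq_sum_phaseExp_smul (hv : ∀ n m, Odd (n + m) → inner ℂ (v n) (v m) = 0)
    (c : ℕ → ℂ) (t : Finset ℕ) :
    ∫⁻ φ, ‖∑ n ∈ t, (c n * phaseExp (-n) φ) • v n‖ₑ ^ 2 ∂phaseMeasure =
      ∑ n ∈ t, ‖c n‖ₑ ^ 2 * ‖v n‖ₑ ^ 2 := by
  have hi : Integrable (fun φ => ‖∑ n ∈ t, (c n * phaseExp (-n) φ) • v n‖ ^ 2) phaseMeasure :=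
    integrable_phaseMeasure_of_continuous (by fun_prop)
  have h := ofReal_integral_eq_lintegral_ofReal hi (Eventually.of_forall fun φ => sq_nonneg _)
  rw [integral_norm_sq_sum_phaseExp_smul hv,
    ENNReal.ofReal_sum_of_nonneg fun _ _ => by positivity] at h
  simpa [ENNReal.ofReal_mul, ENNReal.ofReal_pow] using h.symm

end PhaseAverage

theorem norm_sum_numberL2_le (ψ : Fock) (φ : ℝ) (N : ℕ) :
    ‖∑ n ∈ Finset.range N, (ψ n * phaseExp (-n) φ) • numberL2 n‖ ≤ ‖ψ‖ := by
  refine le_of_sq_le_sq ?_ (norm_nonneg _)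
  have hpyth : ‖∑ n ∈ Finset.range N, (ψ n * phaseExp (-n) φ) • numberL2 n‖ ^ 2 =
      ∑ n ∈ Finset.range N, ‖ψ n‖ ^ 2 := by
    simpa using orthonormal_numberL2.orthogonalFamily.norm_sum
      (fun n => ψ n * phaseExp (-n) φ) (Finset.range N)
  rw [hpyth]
  simpa using lp.sum_rpow_le_norm_rpow (p := 2) (by norm_num) ψ (Finset.range N)

theorem lintegral_vecOutcome_apply (ψ : Fock) {B : Set ℝ} (hB : MeasurableSet B)
    (hs : ∀ x, -x ∈ B ↔ x ∈ B) :
    ∫⁻ φ, vecOutcome ψ φ B ∂phaseMeasure =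
      ∑' n, ‖ψ n‖ₑ ^ 2 * ∫⁻ x in B, ‖numberL2 n x‖ₑ ^ 2 := by
  have hbound (N : ℕ) (φ : ℝ) : ‖∑ n ∈ Finset.range N,
      (ψ n * phaseExp (-n) φ) • restrictL2 B (numberL2 n)‖ₑ ≤ ‖restrictL2 B‖ₑ * ‖ψ‖ₑ := by
    simp only [← map_smul, ← map_sum]
    refine ((restrictL2 B).le_opENorm _).trans ?_
    gcongr
    simpa only [ofReal_norm] using ENNReal.ofReal_le_ofReal (norm_sum_numberL2_le ψ φ N)
  have hlim := tendsto_lintegral_of_dominated_convergence (μ := phaseMeasure)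
    (fun _ => (‖restrictL2 B‖ₑ * ‖ψ‖ₑ) ^ 2)
    (fun N => measurable_enorm_sq_sum_phaseExp_smul _ _ (Finset.range N))
    (fun N => Eventually.of_forall fun φ => pow_le_pow_left' (hbound N φ) 2)
    (by simpa using ENNReal.mul_ne_top enorm_ne_top enorm_ne_top)
    (Eventually.of_forall fun φ => tendsto_enorm_sq_restrictL2 B φ ψ)
  simp_rw [lintegral_enorm_sq_sum_phaseExp_smul
    (fun _ _ hnm => inner_restrictL2_numberL2 hB hs hnm), enorm_restrictL2_sq] at hlim
  simp_rw [vecOutcome_apply ψ _ hB, enorm_restrictL2_sq]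
  exact tendsto_nhds_unique hlim ENNReal.summable.hasSum.tendsto_sum_nat

theorem map_abs_bind_vecOutcome (ψ : Fock) :
    (phaseMeasure.bind (vecOutcome ψ)).map abs =
      (Measure.sum fun n => ‖ψ n‖ₑ ^ 2 •
        (volume : Measure ℝ).withDensity fun x => ‖numberL2 n x‖ₑ ^ 2).map abs := by
  ext B hB
  have hB' : MeasurableSet (abs ⁻¹' B : Set ℝ) := measurable_abs hB
  rw [Measure.map_apply measurable_abs hB, Measure.map_apply measurable_abs hB,
    Measure.bind_apply hB' (measurable_vecOutcome ψ).aemeasurable,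
    lintegral_vecOutcome_apply ψ hB' (by simp), Measure.sum_apply _ hB']
  simp only [Measure.smul_apply, withDensity_apply _ hB', smul_eq_mul]

theorem lintegral_vecOutcome_of_even (ψ : Fock) {w : ℝ → ℝ≥0∞} (hw : Measurable w)
    (heven : Function.Even w) :
    ∫⁻ φ, ∫⁻ x, w x ∂(vecOutcome ψ φ) ∂phaseMeasure =
      ∑' n, ‖ψ n‖ₑ ^ 2 * ∫⁻ x, w x * ‖numberL2 n x‖ₑ ^ 2 := by
  have habs (x : ℝ) : w |x| = w x := by
    rcases abs_choice x with h | h <;> simp [h, heven.eq]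
  have h := congrArg (fun μ => ∫⁻ x, w x ∂μ) (map_abs_bind_vecOutcome ψ)
  simp only [lintegral_map hw measurable_abs, habs, lintegral_sum_measure, lintegral_smul_measure,
    Measure.lintegral_bind (measurable_vecOutcome ψ).aemeasurable hw.aemeasurable] at h
  rw [h]
  refine tsum_congr fun n => ?_
  rw [lintegral_withDensity_eq_lintegral_mul _
    ((Lp.stronglyMeasurable _).measurable.enorm.pow_const 2) hw, smul_eq_mul]
  simp only [Pi.mul_apply, mul_comm]

/-! ### Matrix elements of powers of the position -/

/-- The matrix element `⟨n| X_0^m |n'⟩` of a power of the quadrature at phase `0`. -/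
def matrixElement (m n n' : ℕ) : ℝ := ∫ x, x ^ m * (numberFn n x * numberFn n' x)

theorem integrable_pow_mul_numberFn (m n n' : ℕ) :
    Integrable fun x : ℝ => x ^ m * (numberFn n x * numberFn n' x) := by
  refine (integrable_poly_gauss (X ^ m * (C (√(√(2 / Real.pi) / (n.factorial : ℝ)) *
    √(√(2 / Real.pi) / (n'.factorial : ℝ))) * ((hermiteR n * hermiteR n').comp (C 2 * X))))
    (b := 2) (by norm_num)).congr (Eventually.of_forall fun x => ?_)
  simp only [numberFn_mul_eq, eval_mul (p := X ^ m), eval_pow, eval_X, mul_assoc]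

theorem matrixElement_zero (n n' : ℕ) : matrixElement 0 n n' = if n = n' then 1 else 0 := by
  simp only [matrixElement, pow_zero, one_mul, integral_numberFn_mul]

theorem matrixElement_succ (m n n' : ℕ) : 2 * matrixElement (m + 1) n n' =
    √((n : ℝ) + 1) * matrixElement m (n + 1) n' + √(n : ℝ) * matrixElement m (n - 1) n' := by
  simp only [matrixElement]
  rw [← integral_const_mul, ← integral_const_mul, ← integral_const_mul,
    ← integral_add ((integrable_pow_mul_numberFn _ _ _).const_mul _)
      ((integrable_pow_mul_numberFn _ _ _).const_mul _)]
  congr 1 with x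
  linear_combination x ^ m * numberFn n' x * numberFn_recurrence n x

theorem abs_sub_le_and_even_of_matrixElement_ne_zero {m n n' : ℕ} (h : matrixElement m n n' ≠ 0) :
    |(n : ℤ) - n'| ≤ m ∧ Even ((n : ℤ) - n' + m) := by
  induction m generalizing n with
  | zero =>
    obtain rfl : n = n' := by
      by_contra hn
      exact h (by rw [matrixElement_zero, if_neg hn])
    simp
  | succ m ih =>
    have hsucc := matrixElement_succ m n n'
    simp only [abs_le, even_iff_exists_two_mul] at ih ⊢
    by_cases hup : matrixElement m (n + 1) n' = 0
    · have hdown : √(n : ℝ) * matrixElement m (n - 1) n' ≠ 0 := by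
        rw [hup, mul_zero, zero_add] at hsucc
        exact hsucc ▸ mul_ne_zero two_ne_zero h
      have hn : n ≠ 0 := by
        rintro rfl
        simp at hdown
      obtain ⟨hle, r, hr⟩ := ih (right_ne_zero_of_mul hdown)
      exact ⟨by omega, r + 1, by omega⟩
    · obtain ⟨hle, r, hr⟩ := ih hup
      exact ⟨by omega, r, by omega⟩

theorem memLp_pow_mul_numberFn (a n : ℕ) :
    MemLp (fun x : ℝ => ((x ^ a * numberFn n x : ℝ) : ℂ)) 2 volume := by
  refine (memLp_poly (C (√(√(2 / Real.pi) / (n.factorial : ℝ))) * (C (1 / 2) * X) ^ a *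
    hermiteR n)).ae_eq (Eventually.of_forall fun x => ?_)
  simp only [numberFn, eval_mul, eval_C, eval_pow, eval_X]
  rw [show (1 / 2 : ℝ) * (2 * x) = x by ring]
  congr 1
  ring

/-- The vector `x^a u_n` of `L²(ℝ)`. -/
def powNumberL2 (a n : ℕ) : Lp ℂ 2 (volume : Measure ℝ) := (memLp_pow_mul_numberFn a n).toLp _

theorem coeFn_powNumberL2 (a n : ℕ) :
    powNumberL2 a n =ᵐ[volume] fun x : ℝ => (x : ℂ) ^ a • numberL2 n x := by
  filter_upwards [(memLp_pow_mul_numberFn a n).coeFn_toLp, coeFn_numberL2 n] with x hpow hx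
  rw [powNumberL2, hpow, hx]
  push_cast
  rfl

theorem inner_powNumberL2 (a b n n' : ℕ) :
    inner ℂ (powNumberL2 a n) (powNumberL2 b n') = (matrixElement (a + b) n n' : ℂ) := by
  rw [L2.inner_def, matrixElement, ← integral_complex_ofReal]
  refine integral_congr_ae ?_
  filter_upwards [(memLp_pow_mul_numberFn a n).coeFn_toLp,
    (memLp_pow_mul_numberFn b n').coeFn_toLp] with x h₁ h₂
  rw [powNumberL2, powNumberL2, h₁, h₂, RCLike.inner_apply, Complex.conj_ofReal,
    ← Complex.ofReal_mul]
  congr 1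
  ring

theorem enorm_ofReal (x : ℝ) : ‖(x : ℂ)‖ₑ = ‖x‖ₑ := by simp [enorm_eq_nnnorm]

theorem enorm_powNumberL2_sq (a n : ℕ) :
    ‖powNumberL2 a n‖ₑ ^ 2 = ∫⁻ x, ‖x‖ₑ ^ (2 * a) * ‖numberL2 n x‖ₑ ^ 2 := by
  rw [enorm_sq_eq_lintegral]
  refine lintegral_congr_ae ?_
  filter_upwards [coeFn_powNumberL2 a n] with x hx
  rw [hx, enorm_smul, enorm_pow, enorm_ofReal, mul_pow, ← pow_mul, mul_comm a 2]

/-! ### Almost orthogonal series -/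

section AlmostOrthogonal

variable {𝕜 E ι : Type*} [RCLike 𝕜] [NormedAddCommGroup E] [InnerProductSpace 𝕜 E] {y : ι → E}
  {s : ι → Finset ι} {D : ℕ}

theorem norm_sum_sq_le_of_inner_ne_zero (hs : ∀ i j, inner 𝕜 (y i) (y j) ≠ 0 → j ∈ s i)
    (hD : ∀ i, (s i).card ≤ D) (t : Finset ι) :
    ‖∑ i ∈ t, y i‖ ^ 2 ≤ D * ∑ i ∈ t, ‖y i‖ ^ 2 := by
  classical
  let χ (i j : ι) : ℝ := if inner 𝕜 (y i) (y j) = 0 then 0 else 1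
  have hsymm (i j : ι) : χ i j = χ j i := by simp only [χ, inner_eq_zero_symm]
  have hrow (i : ι) : ∑ j ∈ t, χ i j ≤ D := by
    have hsub : {j ∈ t | ¬inner 𝕜 (y i) (y j) = 0} ⊆ s i := fun j hj =>
      hs i j (Finset.mem_filter.1 hj).2
    simpa [χ, Finset.sum_ite] using (Finset.card_le_card hsub).trans (hD i)
  have hinner (i j : ι) :
      ‖inner 𝕜 (y i) (y j)‖ ≤ (χ i j * ‖y i‖ ^ 2 + χ j i * ‖y j‖ ^ 2) / 2 := by
    rw [hsymm j i]
    by_cases h : inner 𝕜 (y i) (y j) = 0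
    · simp [χ, h]
    · simp only [χ, if_neg h, one_mul]
      linarith [norm_inner_le_norm (𝕜 := 𝕜) (y i) (y j), two_mul_le_add_sq ‖y i‖ ‖y j‖]
  calc ‖∑ i ∈ t, y i‖ ^ 2 = ‖∑ i ∈ t, ∑ j ∈ t, inner 𝕜 (y i) (y j)‖ := by
        simp only [← inner_sum, ← sum_inner]
        simp [inner_self_eq_norm_sq_to_K]
    _ ≤ ∑ i ∈ t, ∑ j ∈ t, (χ i j * ‖y i‖ ^ 2 + χ j i * ‖y j‖ ^ 2) / 2 :=
        norm_sum_le_of_le _ fun i _ => norm_sum_le_of_le _ fun j _ => hinner i j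
    _ = ∑ i ∈ t, (∑ j ∈ t, χ i j) * ‖y i‖ ^ 2 := by
        simp only [← Finset.sum_div, Finset.sum_add_distrib]
        rw [Finset.sum_comm (f := fun i j => χ j i * ‖y j‖ ^ 2), add_self_div_two]
        simp only [Finset.sum_mul]
    _ ≤ D * ∑ i ∈ t, ‖y i‖ ^ 2 := by
        rw [Finset.mul_sum]
        gcongr with i
        exact hrow i

theorem summable_of_inner_ne_zero [CompleteSpace E]
    (hs : ∀ i j, inner 𝕜 (y i) (y j) ≠ 0 → j ∈ s i) (hD : ∀ i, (s i).card ≤ D)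
    (hy : Summable fun i => ‖y i‖ ^ 2) : Summable y := by
  rw [summable_iff_vanishing_norm] at hy ⊢
  intro ε hε
  obtain ⟨u, hu⟩ := hy (ε ^ 2 / (D + 1)) (by positivity)
  refine ⟨u, fun t ht => lt_of_pow_lt_pow_left₀ 2 hε.le ?_⟩
  have htail := hu t ht
  rw [Real.norm_of_nonneg (by positivity), lt_div_iff₀ (by positivity)] at htail
  calc ‖∑ i ∈ t, y i‖ ^ 2 ≤ D * ∑ i ∈ t, ‖y i‖ ^ 2 := norm_sum_sq_le_of_inner_ne_zero hs hD t
    _ ≤ (∑ i ∈ t, ‖y i‖ ^ 2) * (D + 1) := by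
        rw [mul_comm]
        gcongr
        linarith
    _ < ε ^ 2 := htail

end AlmostOrthogonal

/-! ### Moments of a pure state -/

/-- The phase averaged moment `∫ dφ/π ⟨X_φ^{2k}⟩` in the pure state `ψ`. -/
def vecMoment (ψ : Fock) (k : ℕ) : ℝ≥0∞ :=
  ∫⁻ φ, ∫⁻ x, ‖x‖ₑ ^ (2 * k) ∂(vecOutcome ψ φ) ∂phaseMeasure

theorem vecMoment_eq_tsum (ψ : Fock) (k : ℕ) :
    vecMoment ψ k = ∑' n, ‖ψ n‖ₑ ^ 2 * ‖powNumberL2 k n‖ₑ ^ 2 := by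
  simp_rw [enorm_powNumberL2_sq]
  exact lintegral_vecOutcome_of_even ψ (by fun_prop) fun x => by rw [enorm_neg]

theorem enorm_pow_le_one_add {m l : ℕ} (h : m ≤ l) (x : ℝ) : ‖x‖ₑ ^ m ≤ 1 + ‖x‖ₑ ^ l := by
  rcases le_total ‖x‖ₑ 1 with hx | hx
  · exact (pow_le_one' hx m).trans le_self_add
  · exact (pow_le_pow_right' hx h).trans le_add_self

theorem vecMoment_ne_top_of_le {ψ : Fock} {a k : ℕ} (hak : a ≤ k) (h : vecMoment ψ k ≠ ⊤) :
    vecMoment ψ a ≠ ⊤ := by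
  refine ne_top_of_le_ne_top (b := ‖ψ‖ₑ ^ 2 + vecMoment ψ k) (by finiteness) ?_
  calc vecMoment ψ a
      ≤ ∫⁻ φ, (‖ψ‖ₑ ^ 2 + ∫⁻ x, ‖x‖ₑ ^ (2 * k) ∂(vecOutcome ψ φ)) ∂phaseMeasure := by
        refine lintegral_mono fun φ => ?_
        rw [← vecOutcome_univ ψ φ, ← lintegral_one, ← lintegral_add_left (by fun_prop)]
        exact lintegral_mono fun x => enorm_pow_le_one_add (by omega) x
    _ = ‖ψ‖ₑ ^ 2 + vecMoment ψ k := by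
        rw [lintegral_add_left (by fun_prop)]
        simp [vecMoment]

/-- The vector `X_φ^a ψ` in the spectral representation of `X_φ`, as a series over the number
states; it is `0` by convention when the series is not summable. -/
def quadraturePow (a : ℕ) (φ : ℝ) (ψ : Fock) : Lp ℂ 2 (volume : Measure ℝ) :=
  ∑' n : ℕ, (ψ n * phaseExp (-n) φ) • powNumberL2 a n

theorem hasSum_quadraturePow {ψ : Fock} {a : ℕ} (h : vecMoment ψ a ≠ ⊤) (φ : ℝ) :
    HasSum (fun n : ℕ => (ψ n * phaseExp (-n) φ) • powNumberL2 a n) (quadraturePow a φ ψ) := by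
  refine (summable_of_inner_ne_zero (𝕜 := ℂ) (s := fun n => Finset.Icc (n - 2 * a) (n + 2 * a))
    (D := 4 * a + 1) (fun n m hnm => ?_) (fun n => ?_) ?_).hasSum
  · rw [inner_smul_left, inner_smul_right, inner_powNumberL2] at hnm
    have hband := (abs_sub_le_and_even_of_matrixElement_ne_zero
      (Complex.ofReal_ne_zero.1 (right_ne_zero_of_mul (right_ne_zero_of_mul hnm)))).1
    rw [abs_le] at hband
    rw [Finset.mem_Icc]
    omega
  · rw [Nat.card_Icc]
    omega
  · rw [vecMoment_eq_tsum] at h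
    refine (ENNReal.summable_toReal h).congr fun n => ?_
    simp [norm_smul, mul_pow, ENNReal.toReal_mul]

theorem ae_eq_smul_of_tendsto {α 𝕜 E : Type*} {_ : MeasurableSpace α} {μ : Measure α}
    [NormedField 𝕜] [NormedAddCommGroup E] [NormedSpace 𝕜 E] {p : ℝ≥0∞} [Fact (1 ≤ p)]
    {F G : ℕ → Lp E p μ} {f g : Lp E p μ} {w : α → 𝕜} (hF : Tendsto F atTop (𝓝 f))
    (hG : Tendsto G atTop (𝓝 g)) (h : ∀ N, G N =ᵐ[μ] fun x => w x • F N x) :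
    g =ᵐ[μ] fun x => w x • f x := by
  obtain ⟨ns, hns, hGae⟩ := (tendstoInMeasure_of_tendsto_Lp hG).exists_seq_tendsto_ae
  obtain ⟨ms, hms, hFae⟩ := (tendstoInMeasure_of_tendsto_Lp
    (hF.comp hns.tendsto_atTop)).exists_seq_tendsto_ae
  filter_upwards [hGae, hFae, ae_all_iff.2 h] with x hGx hFx hx
  exact tendsto_nhds_unique (hGx.comp hms.tendsto_atTop)
    ((hFx.const_smul (w x)).congr fun i => (hx _).symm)

theorem coeFn_sum_smul_powNumberL2 (a : ℕ) (c : ℕ → ℂ) (t : Finset ℕ) :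
    (∑ n ∈ t, c n • powNumberL2 a n : Lp ℂ 2 (volume : Measure ℝ)) =ᵐ[volume]
      fun x : ℝ => (x : ℂ) ^ a • (∑ n ∈ t, c n • numberL2 n : Lp ℂ 2 (volume : Measure ℝ)) x := by
  filter_upwards [Lp.coeFn_fun_finsetSum t fun n => c n • powNumberL2 a n,
    Lp.coeFn_fun_finsetSum t fun n => c n • numberL2 n,
    ae_all_iff.2 fun n => Lp.coeFn_smul (c n) (powNumberL2 a n),
    ae_all_iff.2 fun n => Lp.coeFn_smul (c n) (numberL2 n),
    ae_all_iff.2 fun n => coeFn_powNumberL2 a n] with x hpow hnum hpows hnums hx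
  simp only [hpow, hnum, hpows, hnums, hx, Pi.smul_apply, Finset.smul_sum]
  exact Finset.sum_congr rfl fun n _ => smul_comm _ _ _

theorem coeFn_quadraturePow {ψ : Fock} {a : ℕ} (h : vecMoment ψ a ≠ ⊤) (φ : ℝ) :
    quadraturePow a φ ψ =ᵐ[volume] fun x : ℝ => (x : ℂ) ^ a • quadratureRep φ ψ x :=
  ae_eq_smul_of_tendsto (hasSum_quadratureRep φ ψ).tendsto_sum_nat
    (hasSum_quadraturePow h φ).tendsto_sum_nat fun _ => coeFn_sum_smul_powNumberL2 a _ _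

theorem measurable_enorm_quadratureRep_sq (φ : ℝ) (ψ : Fock) :
    Measurable fun x => ‖quadratureRep φ ψ x‖ₑ ^ 2 :=
  (Lp.stronglyMeasurable _).measurable.enorm.pow_const 2

theorem enorm_quadraturePow_sq {ψ : Fock} {k : ℕ} (h : vecMoment ψ k ≠ ⊤) (φ : ℝ) :
    ‖quadraturePow k φ ψ‖ₑ ^ 2 = ∫⁻ x, ‖x‖ₑ ^ (2 * k) ∂(vecOutcome ψ φ) := by
  rw [enorm_sq_eq_lintegral, vecOutcome, lintegral_withDensity_eq_lintegral_mul _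
    (measurable_enorm_quadratureRep_sq φ ψ) (by fun_prop)]
  refine lintegral_congr_ae ?_
  filter_upwards [coeFn_quadraturePow h φ] with x hx
  rw [hx, Pi.mul_apply, enorm_smul, enorm_pow, enorm_ofReal, mul_pow, ← pow_mul, mul_comm k 2,
    mul_comm]

theorem integral_pow_vecOutcome {ψ : Fock} {a b : ℕ} (ha : vecMoment ψ a ≠ ⊤)
    (hb : vecMoment ψ b ≠ ⊤) (φ : ℝ) :
    ∫ x : ℝ, (x : ℂ) ^ (a + b) ∂(vecOutcome ψ φ) =
      inner ℂ (quadraturePow a φ ψ) (quadraturePow b φ ψ) := by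
  rw [vecOutcome, L2.inner_def, integral_withDensity_eq_integral_toReal_smul
    (measurable_enorm_quadratureRep_sq φ ψ) (by simp)]
  refine integral_congr_ae ?_
  filter_upwards [coeFn_quadraturePow ha φ, coeFn_quadraturePow hb φ] with x h₁ h₂
  rw [h₁, h₂, RCLike.inner_apply, smul_eq_mul, smul_eq_mul, map_mul, map_pow, Complex.conj_ofReal,
    ENNReal.toReal_pow, toReal_enorm, Complex.real_smul]
  push_cast
  rw [← Complex.mul_conj']
  ring

theorem inner_quadraturePow_mem_trigSpan {ψ : Fock} {a b : ℕ} (ha : vecMoment ψ a ≠ ⊤)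
    (hb : vecMoment ψ b ≠ ⊤) :
    (fun φ => inner ℂ (quadraturePow a φ ψ) (quadraturePow b φ ψ)) ∈ trigSpan (a + b) := by
  refine (isClosed_trigSpan (a + b)).mem_of_tendsto (b := atTop)
    (f := fun (N : ℕ) φ => inner ℂ
      (∑ n ∈ Finset.range N, (ψ n * phaseExp (-n) φ) • powNumberL2 a n)
      (∑ n ∈ Finset.range N, (ψ n * phaseExp (-n) φ) • powNumberL2 b n))
    (tendsto_pi_nhds.2 fun φ => (hasSum_quadraturePow ha φ).tendsto_sum_nat.inner
      (hasSum_quadraturePow hb φ).tendsto_sum_nat) (Eventually.of_forall fun N => ?_)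
  have hexpand : (fun φ => inner ℂ
      (∑ n ∈ Finset.range N, (ψ n * phaseExp (-n) φ) • powNumberL2 a n)
      (∑ n ∈ Finset.range N, (ψ n * phaseExp (-n) φ) • powNumberL2 b n)) =
      ∑ n ∈ Finset.range N, ∑ m ∈ Finset.range N,
        (starRingEnd ℂ (ψ n) * ψ m * matrixElement (a + b) n m) • phaseExp (n - m) := by
    ext φ
    simp only [inner_sum_phaseExp_smul, inner_powNumberL2, Finset.sum_apply, Pi.smul_apply,
      smul_eq_mul]
  rw [hexpand]
  refine Submodule.sum_mem _ fun n _ => Submodule.sum_mem _ fun m _ => ?_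
  by_cases h : matrixElement (a + b) n m = 0
  · simp [h]
  · obtain ⟨hle, heven⟩ := abs_sub_le_and_even_of_matrixElement_ne_zero h
    exact Submodule.smul_mem _ _ (phaseExp_mem_trigSpan hle heven)

theorem lintegral_pow_vecOutcome_le (ψ : Fock) (k : ℕ) (θ : ℝ) :
    ∫⁻ x, ‖x‖ₑ ^ (2 * k) ∂(vecOutcome ψ θ) ≤ (2 * k + 1) * vecMoment ψ k := by
  by_cases h : vecMoment ψ k = ⊤
  · simp [h, ENNReal.mul_top]
  set g : ℝ → ℂ := fun φ => inner ℂ (quadraturePow k φ ψ) (quadraturePow k φ ψ)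
  have hg : g ∈ trigSpan (k + k) := inner_quadraturePow_mem_trigSpan h h
  have hmoment (φ : ℝ) : ‖g φ‖ₑ = ∫⁻ x, ‖x‖ₑ ^ (2 * k) ∂(vecOutcome ψ φ) := by
    rw [← enorm_quadraturePow_sq h]
    simp [g, inner_self_eq_norm_sq_to_K, enorm_ofReal]
  calc ∫⁻ x, ‖x‖ₑ ^ (2 * k) ∂(vecOutcome ψ θ) = ENNReal.ofReal ‖g θ‖ := by
        rw [← hmoment, ofReal_norm]
    _ ≤ ENNReal.ofReal (((k + k : ℕ) + 1) * ∫ φ, ‖g φ‖ ∂phaseMeasure) :=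
        ENNReal.ofReal_le_ofReal (norm_le_of_mem_trigSpan hg θ)
    _ = (2 * k + 1) * vecMoment ψ k := by
        rw [ENNReal.ofReal_mul (by positivity), ofReal_integral_norm_eq_lintegral_enorm
          (integrable_phaseMeasure_of_continuous (continuous_of_mem_trigSpan hg))]
        simp_rw [hmoment]
        rw [← two_mul, ENNReal.ofReal_add (by positivity) zero_le_one, ENNReal.ofReal_natCast,
          vecMoment]
        simp

/-! ### Moments of a state -/

/-- The absolute moment `⟨|X_φ|^m⟩` in the state `ρ`. -/
def State.absMoment (ρ : State) (m : ℕ) (φ : ℝ) : ℝ≥0∞ := ∫⁻ x, ‖x‖ₑ ^ m ∂(ρ.outcome φ)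

/-- The moment `⟨X_φ^m⟩` in the state `ρ`; it is `0` by convention when `X_φ^m` is not
integrable. -/
def State.moment (ρ : State) (m : ℕ) (φ : ℝ) : ℂ := ∫ x : ℝ, (x : ℂ) ^ m ∂(ρ.outcome φ)

namespace State

variable (ρ : State)

theorem measurable_absMoment (m : ℕ) : Measurable (ρ.absMoment m) :=
  (Measure.measurable_lintegral (by fun_prop)).comp ρ.kernel.measurable

theorem absMoment_eq_tsum (m : ℕ) (φ : ℝ) :
    ρ.absMoment m φ = ∑' j, ∫⁻ x, ‖x‖ₑ ^ m ∂(vecOutcome (ρ.vec j) φ) := by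
  rw [absMoment, outcome_eq_sum, lintegral_sum_measure]

theorem meanMoment_eq_tsum (k : ℕ) : ρ.meanMoment k = ∑' j, vecMoment (ρ.vec j) k := by
  refine (lintegral_congr fun φ => ρ.absMoment_eq_tsum (2 * k) φ).trans (lintegral_tsum fun j => ?_)
  exact ((Measure.measurable_lintegral (by fun_prop)).comp (measurable_vecOutcome _)).aemeasurable

theorem absMoment_two_mul_le (k : ℕ) (φ : ℝ) :
    ρ.absMoment (2 * k) φ ≤ (2 * k + 1) * ρ.meanMoment k := by
  rw [absMoment_eq_tsum, meanMoment_eq_tsum, ← ENNReal.tsum_mul_left]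
  exact ENNReal.tsum_le_tsum fun j => lintegral_pow_vecOutcome_le _ _ _

theorem absMoment_le_one_add {m l : ℕ} (h : m ≤ l) (φ : ℝ) :
    ρ.absMoment m φ ≤ 1 + ρ.absMoment l φ := by
  refine (lintegral_mono fun x => enorm_pow_le_one_add h x).trans_eq ?_
  rw [lintegral_add_left (by fun_prop), lintegral_one, measure_univ, absMoment]

theorem absMoment_le (k s : ℕ) (φ : ℝ) :
    ρ.absMoment (2 * k + s) φ ≤ 2 * ((k + s : ℕ) + 1) * (1 + ρ.meanMoment (k + s)) := by
  have hle : 2 * k + s ≤ 2 * (k + s) := by omega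
  calc ρ.absMoment (2 * k + s) φ ≤ 1 + (2 * (k + s : ℕ) + 1) * ρ.meanMoment (k + s) := by
        refine (ρ.absMoment_le_one_add hle φ).trans ?_
        gcongr
        exact ρ.absMoment_two_mul_le _ φ
    _ ≤ (2 * (k + s : ℕ) + 1) + (2 * (k + s : ℕ) + 1) * ρ.meanMoment (k + s) := by
        gcongr
        exact le_add_self
    _ = (2 * (k + s : ℕ) + 1) * (1 + ρ.meanMoment (k + s)) := by ring
    _ ≤ 2 * ((k + s : ℕ) + 1) * (1 + ρ.meanMoment (k + s)) := by
        rw [mul_add 2]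
        gcongr
        norm_num

theorem lintegral_absMoment_le (k s : ℕ) :
    ∫⁻ φ, ρ.absMoment (2 * k + s) φ ∂phaseMeasure ≤ 1 + ρ.meanMoment (k + s) := by
  have hle : 2 * k + s ≤ 2 * (k + s) := by omega
  refine (lintegral_mono fun φ => ρ.absMoment_le_one_add hle φ).trans_eq ?_
  rw [lintegral_add_left (by fun_prop), lintegral_one, measure_univ]
  rfl

variable {ρ} {k s : ℕ}

theorem integrable_pow_outcome (h : ρ.meanMoment (k + s) ≠ ⊤) (φ : ℝ) :
    Integrable (fun x : ℝ => (x : ℂ) ^ (2 * k + s)) (ρ.outcome φ) := by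
  refine ⟨(by fun_prop : Continuous fun x : ℝ => (x : ℂ) ^ (2 * k + s)).aestronglyMeasurable, ?_⟩
  simp only [HasFiniteIntegral, enorm_pow, enorm_ofReal]
  exact (ρ.absMoment_le k s φ).trans_lt (by finiteness)

/-- Splitting `X^{2k+s}` as `X^k X^{k+s}` makes each moment of an ensemble vector an inner product
of two vectors that a finite averaged moment of order `k + s` suffices to define. -/
theorem moment_mem_trigSpan (h : ρ.meanMoment (k + s) ≠ ⊤) :
    ρ.moment (2 * k + s) ∈ trigSpan (2 * k + s) := by
  have hvec (j : ℕ) : vecMoment (ρ.vec j) (k + s) ≠ ⊤ := by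
    rw [meanMoment_eq_tsum] at h
    exact ENNReal.ne_top_of_tsum_ne_top h j
  have hmem (j : ℕ) : (fun φ => ∫ x : ℝ, (x : ℂ) ^ (2 * k + s) ∂(vecOutcome (ρ.vec j) φ)) ∈
      trigSpan (2 * k + s) := by
    have hk := vecMoment_ne_top_of_le (Nat.le_add_right k s) (hvec j)
    rw [two_mul, add_assoc]
    simp only [integral_pow_vecOutcome hk (hvec j)]
    exact inner_quadraturePow_mem_trigSpan hk (hvec j)
  refine (isClosed_trigSpan _).mem_of_tendsto (b := atTop) (tendsto_pi_nhds.2 fun φ => ?_)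
    (Eventually.of_forall fun N => Submodule.sum_mem (t := Finset.range N) _ fun j _ => hmem j)
  have hint := integrable_pow_outcome h φ
  rw [moment]
  rw [outcome_eq_sum] at hint ⊢
  simpa only [Finset.sum_apply] using (hasSum_integral_measure hint).tendsto_sum_nat

theorem integral_norm_moment_le (h : ρ.meanMoment (k + s) ≠ ⊤) :
    ∫ φ, ‖ρ.moment (2 * k + s) φ‖ ∂phaseMeasure ≤ (1 + ρ.meanMoment (k + s)).toReal := by
  rw [integral_norm_eq_lintegral_enorm
    (continuous_of_mem_trigSpan (moment_mem_trigSpan h)).aestronglyMeasurable]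
  refine ENNReal.toReal_mono (by finiteness) (le_trans (lintegral_mono fun φ => ?_)
    (ρ.lintegral_absMoment_le k s))
  refine (enorm_integral_le_lintegral_enorm _).trans_eq ?_
  simp only [enorm_pow, enorm_ofReal]
  rfl

end State

/-! ### Averages of estimators given by power series -/

namespace Estimator

variable {e : Estimator} [SFinite e.weight] {ρ : State} {H : ℝ × ℝ → ℂ}

theorem converges_of_integrable (hH : Measurable H)
    (hint : Integrable H (e.weight.compProd ρ.kernel))
    (he : ∀ᵐ φ ∂e.weight, ∀ x, H (φ, x) = e.val φ x) : e.Converges ρ := by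
  refine ⟨?_, ?_, ?_⟩
  · filter_upwards [he, ((Measure.integrable_compProd_iff hH.aestronglyMeasurable).1 hint).1]
      with φ hφ hi
    exact hi.congr (Eventually.of_forall hφ)
  · refine hint.integral_compProd.congr ?_
    filter_upwards [he] with φ hφ
    exact integral_congr_ae (Eventually.of_forall hφ)
  · refine lt_of_eq_of_lt ?_ hint.hasFiniteIntegral
    rw [Measure.lintegral_compProd hH.enorm]
    refine lintegral_congr_ae ?_
    filter_upwards [he] with φ hφ
    exact lintegral_congr fun x => by rw [hφ]

theorem integral_compProd_eq_mean (hint : Integrable H (e.weight.compProd ρ.kernel))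
    (he : ∀ᵐ φ ∂e.weight, ∀ x, H (φ, x) = e.val φ x) :
    ∫ p, H p ∂(e.weight.compProd ρ.kernel) = e.mean ρ := by
  rw [Measure.integral_compProd hint, mean]
  refine integral_congr_ae ?_
  filter_upwards [he] with φ hφ
  exact integral_congr_ae (Eventually.of_forall hφ)

end Estimator

theorem lintegral_enorm_monomial_le {w : Measure ℝ} [SFinite w] {ρ : State} {u : ℝ → ℂ} {B : ℝ≥0∞}
    (hu : Measurable u) (hB : ∀ φ, ‖u φ‖ₑ ≤ B) (m : ℕ) :
    ∫⁻ p : ℝ × ℝ, ‖u p.1 * (p.2 : ℂ) ^ m‖ₑ ∂(w.compProd ρ.kernel) ≤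
      B * ∫⁻ φ, ρ.absMoment m φ ∂w := by
  rw [Measure.lintegral_compProd (by fun_prop), ← lintegral_const_mul _ (ρ.measurable_absMoment m)]
  refine lintegral_mono fun φ => ?_
  simp only [enorm_mul, enorm_pow, enorm_ofReal]
  rw [lintegral_const_mul _ (by fun_prop)]
  gcongr
  · exact hB φ
  · rfl

theorem Estimator.converges_and_hasSum_mean {e : Estimator} [SFinite e.weight] {ρ : State}
    {u : ℕ → ℝ → ℂ} {B : ℕ → ℝ≥0∞} {m : ℕ → ℕ} (hu : ∀ k, Measurable (u k))
    (hB : ∀ k φ, ‖u k φ‖ₑ ≤ B k)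
    (hsum : ∑' k, B k * ∫⁻ φ, ρ.absMoment (m k) φ ∂e.weight ≠ ⊤)
    (he : ∀ᵐ φ ∂e.weight, ∀ x : ℝ, HasSum (fun k => u k φ * (x : ℂ) ^ m k) (e.val φ x)) :
    e.Converges ρ ∧
      HasSum (fun k => ∫ φ, u k φ * ρ.moment (m k) φ ∂e.weight) (e.mean ρ) := by
  let term (k : ℕ) (p : ℝ × ℝ) : ℂ := u k p.1 * (p.2 : ℂ) ^ m k
  have hterm (k : ℕ) : Measurable (term k) := by fun_prop
  have hlint : ∑' k, ∫⁻ p, ‖term k p‖ₑ ∂(e.weight.compProd ρ.kernel) ≠ ⊤ :=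
    ne_top_of_le_ne_top hsum
      (ENNReal.tsum_le_tsum fun k => lintegral_enorm_monomial_le (hu k) (hB k) (m k))
  have hint (k : ℕ) : Integrable (term k) (e.weight.compProd ρ.kernel) :=
    ⟨(hterm k).aestronglyMeasurable, (ENNReal.ne_top_of_tsum_ne_top hlint k).lt_top⟩
  have hsumInt : Integrable (fun p => ∑' k, term k p) (e.weight.compProd ρ.kernel) := by
    refine ⟨(Measurable.tsum hterm).aestronglyMeasurable, lt_of_le_of_lt ?_ hlint.lt_top⟩
    rw [← lintegral_tsum fun k => (hterm k).enorm.aemeasurable]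
    exact lintegral_mono fun p => enorm_tsum_le_tsum_enorm
  have heq : ∀ᵐ φ ∂e.weight, ∀ x, ∑' k, term k (φ, x) = e.val φ x := by
    filter_upwards [he] with φ hφ x using (hφ x).tsum_eq
  refine ⟨converges_of_integrable (Measurable.tsum hterm) hsumInt heq, ?_⟩
  rw [← integral_compProd_eq_mean hsumInt heq]
  refine (hasSum_integral_of_summable_integral_norm hint ?_).congr_fun fun k => ?_
  · refine (ENNReal.summable_toReal hlint).congr fun k => ?_
    rw [integral_norm_eq_lintegral_enorm (hterm k).aestronglyMeasurable]
  · simp only [Measure.integral_compProd (hint k), term, integral_const_mul]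
    rfl

instance (n : ℝ → ℝ → ℂ) : SFinite (Estimator.mulDelta n).weight :=
  inferInstanceAs (SFinite (ENNReal.ofReal (1 / Real.pi) • Measure.dirac (0 : ℝ)))

instance (n : ℝ → ℝ → ℂ) : SFinite (Estimator.ofFun n).weight :=
  inferInstanceAs (SFinite phaseMeasure)

theorem tsum_ne_top_of_le_mul {ι : Type*} {f g : ι → ℝ≥0∞} {C : ℝ≥0∞} (hC : C ≠ ⊤)
    (hg : ∑' i, g i ≠ ⊤) (hle : ∀ i, f i ≤ C * g i) : ∑' i, f i ≠ ⊤ := by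
  refine ne_top_of_le_ne_top (ENNReal.mul_ne_top hC hg) ?_
  rw [← ENNReal.tsum_mul_left]
  exact ENNReal.tsum_le_tsum hle

section PowerSeries

variable {ρ : State} {s : ℕ} {a : ℕ → ℂ} {F : ℝ → ℂ} {E : ℝ → ℝ → ℂ}
  (h : ∑' k : ℕ, ((k + s : ℕ) + 1) * ‖a k‖ₑ * (1 + ρ.meanMoment (k + s)) ≠ ⊤)
include h

theorem meanMoment_ne_top_of_tsum {k : ℕ} (hk : a k ≠ 0) : ρ.meanMoment (k + s) ≠ ⊤ := by
  intro htop
  refine ENNReal.ne_top_of_tsum_ne_top h k ?_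
  rw [htop, add_top, ENNReal.mul_top (mul_ne_zero (by simp) (enorm_ne_zero.2 hk))]

theorem mulDelta_converges_and_hasSum_mean
    (hF : ∀ x : ℝ, HasSum (fun k => a k * (x : ℂ) ^ (2 * k + s)) (F x)) :
    (Estimator.mulDelta fun _ x => F x).Converges ρ ∧
      HasSum (fun k => (1 / Real.pi : ℂ) * a k * ρ.moment (2 * k + s) 0)
        ((Estimator.mulDelta fun _ x => F x).mean ρ) := by
  refine (Estimator.converges_and_hasSum_mean (u := fun k _ => a k) (B := fun k => ‖a k‖ₑ)
    (m := fun k => 2 * k + s) (by fun_prop) (fun k _ => le_rfl) ?_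
    (Eventually.of_forall fun _ => hF)).imp_right fun hsum => hsum.congr_fun fun k => ?_
  · simp only [Estimator.mulDelta, lintegral_smul_measure, lintegral_dirac, smul_eq_mul]
    refine tsum_ne_top_of_le_mul (C := ENNReal.ofReal (1 / Real.pi) * 2) (by finiteness) h
      fun k => ?_
    calc ‖a k‖ₑ * (ENNReal.ofReal (1 / Real.pi) * ρ.absMoment (2 * k + s) 0)
        ≤ ‖a k‖ₑ * (ENNReal.ofReal (1 / Real.pi) *
            (2 * ((k + s : ℕ) + 1) * (1 + ρ.meanMoment (k + s)))) := by
          gcongr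
          exact ρ.absMoment_le k s 0
      _ = _ := by ring
  · rw [Estimator.mulDelta, integral_smul_measure, integral_dirac,
      ENNReal.toReal_ofReal (by positivity), Complex.real_smul]
    push_cast
    ring

theorem ofFun_converges_and_hasSum_mean
    (hE : ∀ φ ∈ Set.Ioo 0 Real.pi, ∀ x : ℝ, HasSum (fun k => (1 / Real.pi : ℂ) * a k *
      dirichletKernel (2 * k + s) φ * (x : ℂ) ^ (2 * k + s)) (E φ x)) :
    (Estimator.ofFun E).Converges ρ ∧
      HasSum (fun k => (1 / Real.pi : ℂ) * a k * ρ.moment (2 * k + s) 0)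
        ((Estimator.ofFun E).mean ρ) := by
  refine (Estimator.converges_and_hasSum_mean
    (u := fun k φ => (1 / Real.pi : ℂ) * a k * dirichletKernel (2 * k + s) φ)
    (B := fun k => ‖(1 / Real.pi : ℂ)‖ₑ * ‖a k‖ₑ * (2 * ((k + s : ℕ) + 1)))
    (m := fun k => 2 * k + s) (fun k => by fun_prop) (fun k φ => ?_) ?_ ?_).imp_right
      fun hsum => hsum.congr_fun fun k => ?_
  · rw [enorm_mul, enorm_mul]
    gcongr
    refine (enorm_dirichletKernel_le _ φ).trans ?_
    exact_mod_cast (by omega : 2 * k + s + 1 ≤ 2 * (k + s + 1))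
  · refine tsum_ne_top_of_le_mul (C := ‖(1 / Real.pi : ℂ)‖ₑ * 2) (by finiteness) h fun k => ?_
    refine (mul_le_mul_right (ρ.lintegral_absMoment_le k s) _).trans_eq ?_
    ring
  · filter_upwards [ae_phaseMeasure_mem_Ioo] with φ hφ using hE φ hφ
  · by_cases hk : a k = 0
    · simp [hk]
    · simp only [mul_assoc ((1 / Real.pi : ℂ) * a k), integral_const_mul]
      congr 1
      exact (integral_dirichletKernel_mul
        (State.moment_mem_trigSpan (meanMoment_ne_top_of_tsum h hk))).symm

theorem poissonDelta_converges_and_hasSum_mean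
    (hF : ∀ x : ℝ, HasSum (fun k => a k * (x : ℂ) ^ (2 * k + s)) (F x)) {ε : ℝ} (h0 : 0 ≤ ε)
    (h1 : ε < 1) :
    (Estimator.ofFun fun φ x => F x * phaseExp s φ * poissonDelta ε φ).Converges ρ ∧
      HasSum (fun k => (1 / Real.pi : ℂ) * a k *
        ∫ φ, phaseExp s φ * poissonKernel ε φ * ρ.moment (2 * k + s) φ ∂phaseMeasure)
        ((Estimator.ofFun fun φ x => F x * phaseExp s φ * poissonDelta ε φ).mean ρ) := by
  have hc := continuous_poissonKernel h0 h1
  set C : ℝ := ∑' n : ℤ, ε ^ n.natAbs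
  refine (Estimator.converges_and_hasSum_mean
    (u := fun k φ => (1 / Real.pi : ℂ) * a k * (phaseExp s φ * poissonKernel ε φ))
    (B := fun k => ‖(1 / Real.pi : ℂ)‖ₑ * ‖a k‖ₑ * ENNReal.ofReal C)
    (m := fun k => 2 * k + s) (fun k => Continuous.measurable (by fun_prop)) (fun k φ => ?_) ?_
    (Eventually.of_forall fun φ x => ?_)).imp_right fun hsum => hsum.congr_fun fun k => ?_
  · rw [enorm_mul, enorm_mul, enorm_mul, ← ofReal_norm (phaseExp _ _), norm_phaseExp,
      ENNReal.ofReal_one, one_mul, ← ofReal_norm (poissonKernel _ _)]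
    gcongr
    exact norm_poissonKernel_le h0 h1 φ
  · refine tsum_ne_top_of_le_mul (C := ‖(1 / Real.pi : ℂ)‖ₑ * ENNReal.ofReal C) (by finiteness) h
      fun k => ?_
    calc _ ≤ ‖(1 / Real.pi : ℂ)‖ₑ * ‖a k‖ₑ * ENNReal.ofReal C * (1 + ρ.meanMoment (k + s)) :=
          mul_le_mul_right (ρ.lintegral_absMoment_le k s) _
      _ = ‖(1 / Real.pi : ℂ)‖ₑ * ENNReal.ofReal C *
            (1 * ‖a k‖ₑ * (1 + ρ.meanMoment (k + s))) := by ring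
      _ ≤ _ := by gcongr; exact le_add_self
  · have hval : (1 / Real.pi : ℂ) * (phaseExp s φ * poissonKernel ε φ) * F x =
        F x * phaseExp s φ * poissonDelta ε φ := by
      rw [poissonDelta_eq]; ring
    simp only [Estimator.ofFun]
    rw [← hval]
    exact ((hF x).mul_left _).congr_fun fun k => by ring
  · simp only [mul_assoc ((1 / Real.pi : ℂ) * a k), integral_const_mul]
    rfl

theorem tendsto_tsum_integral_poissonKernel_mul_moment :
    Tendsto (fun ε => ∑' k, (1 / Real.pi : ℂ) * a k *
      ∫ φ, phaseExp s φ * poissonKernel ε φ * ρ.moment (2 * k + s) φ ∂phaseMeasure) (𝓝[<] 1)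
      (𝓝 (∑' k, (1 / Real.pi : ℂ) * a k * ρ.moment (2 * k + s) 0)) := by
  refine tendsto_tsum_of_dominated_convergence
    (bound := fun k => ‖(1 / Real.pi : ℂ)‖ * (2 *
      (((k + s : ℕ) + 1) * ‖a k‖ₑ * (1 + ρ.meanMoment (k + s))).toReal))
    (((ENNReal.summable_toReal h).mul_left 2).mul_left _) (fun k => ?_) ?_
  · by_cases hk : a k = 0
    · simp [hk]
    · exact (tendsto_integral_poissonKernel_mul
        (State.moment_mem_trigSpan (meanMoment_ne_top_of_tsum h hk))).const_mul _
  · filter_upwards [Ioo_mem_nhdsLT (show (0 : ℝ) < 1 by norm_num)] with ε hε k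
    by_cases hk : a k = 0
    · simp [hk]
    have hmean := meanMoment_ne_top_of_tsum h hk
    have hdeg : (((2 * k + s : ℕ) : ℝ) + 1) ≤ 2 * ((k + s : ℕ) + 1) := by
      exact_mod_cast (by omega : 2 * k + s + 1 ≤ 2 * (k + s + 1))
    have hcoeff : (((k + s : ℕ) : ℝ≥0∞) + 1).toReal = (k + s : ℕ) + 1 := by
      rw [ENNReal.toReal_add (by finiteness) (by finiteness), ENNReal.toReal_natCast,
        ENNReal.toReal_one]
    rw [norm_mul, norm_mul, mul_assoc ‖_‖, ENNReal.toReal_mul, ENNReal.toReal_mul, toReal_enorm,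
      hcoeff]
    refine mul_le_mul_of_nonneg_left ?_ (norm_nonneg _)
    calc _ ≤ ‖a k‖ * (((2 * k + s : ℕ) + 1) * ∫ φ, ‖ρ.moment (2 * k + s) φ‖ ∂phaseMeasure) := by
          gcongr
          exact norm_integral_poissonKernel_mul_le hε.1.le hε.2 (State.moment_mem_trigSpan hmean)
      _ ≤ ‖a k‖ * (2 * ((k + s : ℕ) + 1) * (1 + ρ.meanMoment (k + s)).toReal) := by
          gcongr
          exact State.integral_norm_moment_le hmean
      _ = _ := by ring

theorem tendsto_mean_poissonDelta
    (hF : ∀ x : ℝ, HasSum (fun k => a k * (x : ℂ) ^ (2 * k + s)) (F x)) :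
    Tendsto (fun ε => (Estimator.ofFun fun φ x => F x * phaseExp s φ * poissonDelta ε φ).mean ρ)
      (𝓝[<] 1) (𝓝 (∑' k, (1 / Real.pi : ℂ) * a k * ρ.moment (2 * k + s) 0)) := by
  refine (tendsto_tsum_integral_poissonKernel_mul_moment h).congr' ?_
  filter_upwards [Ioo_mem_nhdsLT (show (0 : ℝ) < 1 by norm_num)] with ε hε
  exact (poissonDelta_converges_and_hasSum_mean h hF hε.1.le hε.2).2.tsum_eq

end PowerSeries

section Identities

variable {S : Set State} {s : ℕ} {a : ℕ → ℂ} {F : ℝ → ℂ} {E : ℝ → ℝ → ℂ}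

theorem equiv_mulDelta_ofFun
    (h : ∀ ρ ∈ S, ∑' k : ℕ, ((k + s : ℕ) + 1) * ‖a k‖ₑ * (1 + ρ.meanMoment (k + s)) ≠ ⊤)
    (hF : ∀ x : ℝ, HasSum (fun k => a k * (x : ℂ) ^ (2 * k + s)) (F x))
    (hE : ∀ φ ∈ Set.Ioo 0 Real.pi, ∀ x : ℝ, HasSum (fun k => (1 / Real.pi : ℂ) * a k *
      dirichletKernel (2 * k + s) φ * (x : ℂ) ^ (2 * k + s)) (E φ x)) :
    Estimator.Equiv S (Estimator.mulDelta fun _ x => F x) (Estimator.ofFun E) := by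
  intro ρ hρ
  obtain ⟨hconvF, hsumF⟩ := mulDelta_converges_and_hasSum_mean (h ρ hρ) hF
  obtain ⟨hconvE, hsumE⟩ := ofFun_converges_and_hasSum_mean (h ρ hρ) hE
  exact ⟨hconvF, hconvE, sub_eq_zero.2 (hsumF.unique hsumE)⟩

theorem limEquiv_poissonDelta_ofFun
    (h : ∀ ρ ∈ S, ∑' k : ℕ, ((k + s : ℕ) + 1) * ‖a k‖ₑ * (1 + ρ.meanMoment (k + s)) ≠ ⊤)
    (hF : ∀ x : ℝ, HasSum (fun k => a k * (x : ℂ) ^ (2 * k + s)) (F x))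
    (hE : ∀ φ ∈ Set.Ioo 0 Real.pi, ∀ x : ℝ, HasSum (fun k => (1 / Real.pi : ℂ) * a k *
      dirichletKernel (2 * k + s) φ * (x : ℂ) ^ (2 * k + s)) (E φ x)) :
    Estimator.LimEquiv S
      (fun ε => Estimator.ofFun fun φ x => F x * phaseExp s φ * poissonDelta ε φ)
      (Estimator.ofFun E) := by
  intro ρ hρ
  obtain ⟨hconvE, hsumE⟩ := ofFun_converges_and_hasSum_mean (h ρ hρ) hE
  refine ⟨?_, hconvE, ?_⟩
  · filter_upwards [Ioo_mem_nhdsLT (show (0 : ℝ) < 1 by norm_num)] with ε hε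
    exact (poissonDelta_converges_and_hasSum_mean (h ρ hρ) hF hε.1.le hε.2).1
  · simpa only [hsumE.tsum_eq, sub_self] using
      (tendsto_mean_poissonDelta (h ρ hρ) hF).sub_const ((Estimator.ofFun E).mean ρ)

end Identities

theorem hasSum_taylorCoeff {f : ℂ → ℂ} (hf : Differentiable ℂ f) (z : ℂ) :
    HasSum (fun k => taylorCoeff f k * z ^ k) (f z) := by
  refine (Complex.hasSum_taylorSeries_of_entire hf 0 z).congr_fun fun k => ?_
  simp only [taylorCoeff, smul_eq_mul, sub_zero]
  ring

theorem taylorCoeff_id_mul_succ {f : ℂ → ℂ} (hf : Differentiable ℂ f) (k : ℕ) :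
    taylorCoeff (fun z => z * f z) (k + 1) = taylorCoeff f k := by
  have hdiff : ContDiffAt ℂ ((k + 1 : ℕ) : WithTop ℕ∞) f 0 := hf.contDiff.contDiffAt
  rw [taylorCoeff, taylorCoeff, iteratedDeriv_fun_mul contDiffAt_fun_id hdiff,
    Finset.sum_eq_single 1]
  · have hk : (k.factorial : ℂ) ≠ 0 := by exact_mod_cast k.factorial_ne_zero
    rw [iteratedDeriv_fun_id, Nat.factorial_succ, Nat.choose_one_right, Nat.add_sub_cancel]
    push_cast
    field_simp
  · intro i _ hi
    simp [iteratedDeriv_fun_id, hi]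
  · simp

theorem taylorCoeff_pow_mul {f : ℂ → ℂ} (hf : Differentiable ℂ f) (s k : ℕ) :
    taylorCoeff (fun z => z ^ s * f z) (k + s) = taylorCoeff f k := by
  induction s with
  | zero => simp
  | succ s ih =>
    have hs : Differentiable ℂ fun z => z ^ s * f z := by fun_prop
    simpa only [pow_succ', mul_assoc, add_assoc, ih] using taylorCoeff_id_mul_succ hs (k + s)

theorem tsum_enorm_taylorCoeff_ne_top {f : ℂ → ℂ} (hf : Differentiable ℂ f) :
    ∑' k : ℕ, ((k : ℝ≥0∞) + 1) * ‖taylorCoeff f k‖ₑ ≠ ⊤ := by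
  refine ne_top_of_le_ne_top (hasSum_taylorCoeff hf 2).summable.norm.tsum_ofReal_ne_top
    (ENNReal.tsum_le_tsum fun k => ?_)
  rw [ofReal_norm, enorm_mul, enorm_pow, mul_comm]
  have htwo : ‖(2 : ℂ)‖ₑ = 2 := by simp [← ofReal_norm]
  have hpow : k + 1 ≤ 2 ^ k := Nat.lt_two_pow_self
  rw [htwo]
  gcongr
  exact_mod_cast hpow

theorem tsum_ne_top_of_mem_domainOf {f : ℂ → ℂ} (hf : Differentiable ℂ f) {s : ℕ} {ρ : State}
    (hρ : ρ ∈ domainOf fun z => z ^ s * f z) :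
    ∑' k : ℕ, ((k + s : ℕ) + 1) * ‖taylorCoeff f k‖ₑ * (1 + ρ.meanMoment (k + s)) ≠ ⊤ := by
  simp only [mul_add, mul_one, ENNReal.tsum_add]
  refine ENNReal.add_ne_top.2 ⟨?_, ?_⟩
  · refine tsum_ne_top_of_le_mul (C := s + 1) (by finiteness) (tsum_enorm_taylorCoeff_ne_top hf)
      fun k => ?_
    rw [← mul_assoc]
    gcongr
    exact_mod_cast (by nlinarith : k + s + 1 ≤ (s + 1) * (k + 1))
  · refine ne_top_of_le_ne_top (LT.lt.ne hρ) (le_trans (le_of_eq ?_)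
      (ENNReal.tsum_comp_le_tsum_of_injective (add_left_injective s) _))
    simp only [taylorCoeff_pow_mul hf]

/-- The regular representative of `x ^ s * f (x ^ 2) * δ_π(φ)`; the paper has `s = 0` and
`s = 1`. The junk value at `φ = 0`, where both denominators vanish, is irrelevant since a single
phase is negligible. -/
def poissonEstimator (s : ℕ) (f : ℂ → ℂ) (φ x : ℝ) : ℂ := (1 / Real.pi : ℂ) *
  ((x : ℂ) ^ s * phaseExp s φ * f ((x : ℂ) ^ 2 * phaseExp 2 φ) / (1 - phaseExp (-2) φ) +
    (x : ℂ) ^ s * phaseExp (-s) φ * f ((x : ℂ) ^ 2 * phaseExp (-2) φ) / (1 - phaseExp 2 φ))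

theorem hasSum_pow_mul_taylorCoeff {f : ℂ → ℂ} (hf : Differentiable ℂ f) (s : ℕ) (z : ℂ) :
    HasSum (fun k => taylorCoeff f k * z ^ (2 * k + s)) (z ^ s * f (z ^ 2)) :=
  ((hasSum_taylorCoeff hf (z ^ 2)).mul_left (z ^ s)).congr_fun fun k => by ring

theorem hasSum_poissonEstimator {f : ℂ → ℂ} (hf : Differentiable ℂ f) (s : ℕ) {φ : ℝ}
    (hφ : φ ∈ Set.Ioo 0 Real.pi) (x : ℝ) :
    HasSum (fun k => (1 / Real.pi : ℂ) * taylorCoeff f k * dirichletKernel (2 * k + s) φ *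
      (x : ℂ) ^ (2 * k + s)) (poissonEstimator s f φ x) := by
  refine (((((hasSum_taylorCoeff hf _).mul_left _).div_const _).add
    (((hasSum_taylorCoeff hf _).mul_left _).div_const _)).mul_left _).congr_fun fun k => ?_
  have hpos : phaseExp (2 * k + s : ℕ) φ = phaseExp s φ * phaseExp 2 φ ^ k := by
    rw [phaseExp_pow, phaseExp_mul]
    congr 1
    push_cast
    ring
  have hneg : phaseExp (-(2 * k + s : ℕ)) φ = phaseExp (-s) φ * phaseExp (-2) φ ^ k := by
    rw [phaseExp_pow, phaseExp_mul]
    congr 1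
    push_cast
    ring
  rw [dirichletKernel_eq_div hφ, hpos, hneg]
  ring

theorem equiv_poissonEstimator {f : ℂ → ℂ} (hf : Differentiable ℂ f) (s : ℕ) :
    Estimator.Equiv (domainOf fun z => z ^ s * f z)
      (Estimator.mulDelta fun _ x => (x : ℂ) ^ s * f ((x : ℂ) ^ 2))
      (Estimator.ofFun (poissonEstimator s f)) :=
  equiv_mulDelta_ofFun (fun _ => tsum_ne_top_of_mem_domainOf hf)
    (fun x => hasSum_pow_mul_taylorCoeff hf s x) fun _ => hasSum_poissonEstimator hf s

theorem limEquiv_poissonEstimator {f : ℂ → ℂ} (hf : Differentiable ℂ f) (s : ℕ) :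
    Estimator.LimEquiv (domainOf fun z => z ^ s * f z)
      (fun ε => Estimator.ofFun fun φ x =>
        (x : ℂ) ^ s * f ((x : ℂ) ^ 2) * phaseExp s φ * poissonDelta ε φ)
      (Estimator.ofFun (poissonEstimator s f)) :=
  limEquiv_poissonDelta_ofFun (fun _ => tsum_ne_top_of_mem_domainOf hf)
    (fun x => hasSum_pow_mul_taylorCoeff hf s x) fun _ => hasSum_poissonEstimator hf s

theorem phaseExp_one (φ : ℝ) : phaseExp 1 φ = Complex.exp (Complex.I * φ) := by
  rw [phaseExp]
  push_cast
  ring_nf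

theorem poissonEstimator_zero (f : ℂ → ℂ) :
    poissonEstimator 0 f = fun φ x : ℝ => (1 / Real.pi : ℂ) *
      (f ((x : ℂ) ^ 2 * Complex.exp (2 * Complex.I * φ)) / (1 - Complex.exp (-2 * Complex.I * φ)) +
        f ((x : ℂ) ^ 2 * Complex.exp (-2 * Complex.I * φ)) /
          (1 - Complex.exp (2 * Complex.I * φ))) := by
  funext φ x
  simp [poissonEstimator, phaseExp, mul_right_comm]

theorem poissonEstimator_one (f : ℂ → ℂ) :
    poissonEstimator 1 f = fun φ x : ℝ => (1 / Real.pi : ℂ) *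
      ((x : ℂ) * Complex.exp (Complex.I * φ) * f ((x : ℂ) ^ 2 * Complex.exp (2 * Complex.I * φ)) /
          (1 - Complex.exp (-2 * Complex.I * φ)) +
        (x : ℂ) * Complex.exp (-Complex.I * φ) *
          f ((x : ℂ) ^ 2 * Complex.exp (-2 * Complex.I * φ)) /
          (1 - Complex.exp (2 * Complex.I * φ))) := by
  funext φ x
  simp [poissonEstimator, phaseExp, mul_right_comm, mul_comm (φ : ℂ)]

theorem tsum_single_ne_top (ρ : State) : ∑' k : ℕ, ((k + 0 : ℕ) + 1) *
    ‖(Pi.single 0 1 : ℕ → ℂ) k‖ₑ * (1 + ρ.meanMoment (k + 0)) ≠ ⊤ := by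
  rw [tsum_eq_single 0 fun k hk => by simp [hk]]
  simp [State.meanMoment]

theorem hasSum_single_mul_pow (x : ℝ) :
    HasSum (fun k => (Pi.single 0 1 : ℕ → ℂ) k * (x : ℂ) ^ (2 * k + 0)) 1 := by
  simpa using hasSum_single (f := fun k => (Pi.single 0 1 : ℕ → ℂ) k * (x : ℂ) ^ (2 * k + 0)) 0
    fun k hk => by simp [hk]

theorem hasSum_single_mul_dirichletKernel (φ x : ℝ) :
    HasSum (fun k => (1 / Real.pi : ℂ) * (Pi.single 0 1 : ℕ → ℂ) k *
      dirichletKernel (2 * k + 0) φ * (x : ℂ) ^ (2 * k + 0)) (1 / Real.pi : ℂ) := by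
  simpa [dirichletKernel_zero] using hasSum_single (f := fun k => (1 / Real.pi : ℂ) *
    (Pi.single 0 1 : ℕ → ℂ) k * dirichletKernel (2 * k + 0) φ * (x : ℂ) ^ (2 * k + 0)) 0
    fun k hk => by simp [hk]

theorem equiv_mulDelta_one : Estimator.Equiv Set.univ (Estimator.mulDelta fun _ _ => 1)
    (Estimator.ofFun fun _ _ => (1 / Real.pi : ℂ)) :=
  equiv_mulDelta_ofFun (fun ρ _ => tsum_single_ne_top ρ) hasSum_single_mul_pow
    fun φ _ => hasSum_single_mul_dirichletKernel φ

theorem limEquiv_poissonDelta : Estimator.LimEquiv Set.univ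
    (fun ε => Estimator.ofFun fun φ _ => poissonDelta ε φ)
    (Estimator.ofFun fun _ _ => (1 / Real.pi : ℂ)) := by
  simpa [phaseExp_zero_left] using limEquiv_poissonDelta_ofFun (fun ρ _ => tsum_single_ne_top ρ)
    hasSum_single_mul_pow fun φ _ => hasSum_single_mul_dirichletKernel φ

end Homodyne

end

theorem lemma4 :
    -- the two identities, for every entire function
    (∀ f : ℂ → ℂ, Differentiable ℂ f →
      Homodyne.Estimator.Equiv (Homodyne.domainOf f)
        (Homodyne.Estimator.mulDelta fun _ x => f ((x : ℂ) ^ 2))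
        (Homodyne.Estimator.ofFun fun φ x => (1 / Real.pi : ℂ) *
          (f ((x : ℂ) ^ 2 * Complex.exp (2 * Complex.I * φ)) /
              (1 - Complex.exp (-2 * Complex.I * φ)) +
            f ((x : ℂ) ^ 2 * Complex.exp (-2 * Complex.I * φ)) /
              (1 - Complex.exp (2 * Complex.I * φ)))) ∧
      Homodyne.Estimator.Equiv (Homodyne.domainOf fun z => z * f z)
        (Homodyne.Estimator.mulDelta fun _ x => (x : ℂ) * f ((x : ℂ) ^ 2))
        (Homodyne.Estimator.ofFun fun φ x => (1 / Real.pi : ℂ) *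
          ((x : ℂ) * Complex.exp (Complex.I * φ) *
              f ((x : ℂ) ^ 2 * Complex.exp (2 * Complex.I * φ)) /
              (1 - Complex.exp (-2 * Complex.I * φ)) +
            (x : ℂ) * Complex.exp (-Complex.I * φ) *
              f ((x : ℂ) ^ 2 * Complex.exp (-2 * Complex.I * φ)) /
              (1 - Complex.exp (2 * Complex.I * φ)))) ∧
      -- the same with the delta in Poisson form (the phase factor is 1 at the delta's support)
      Homodyne.Estimator.LimEquiv (Homodyne.domainOf f)
        (fun ε => Homodyne.Estimator.ofFun fun φ x =>
          f ((x : ℂ) ^ 2) * Homodyne.poissonDelta ε φ)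
        (Homodyne.Estimator.ofFun fun φ x => (1 / Real.pi : ℂ) *
          (f ((x : ℂ) ^ 2 * Complex.exp (2 * Complex.I * φ)) /
              (1 - Complex.exp (-2 * Complex.I * φ)) +
            f ((x : ℂ) ^ 2 * Complex.exp (-2 * Complex.I * φ)) /
              (1 - Complex.exp (2 * Complex.I * φ)))) ∧
      Homodyne.Estimator.LimEquiv (Homodyne.domainOf fun z => z * f z)
        (fun ε => Homodyne.Estimator.ofFun fun φ x =>
          (x : ℂ) * f ((x : ℂ) ^ 2) * Complex.exp (Complex.I * φ) * Homodyne.poissonDelta ε φ)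
        (Homodyne.Estimator.ofFun fun φ x => (1 / Real.pi : ℂ) *
          ((x : ℂ) * Complex.exp (Complex.I * φ) *
              f ((x : ℂ) ^ 2 * Complex.exp (2 * Complex.I * φ)) /
              (1 - Complex.exp (-2 * Complex.I * φ)) +
            (x : ℂ) * Complex.exp (-Complex.I * φ) *
              f ((x : ℂ) ^ 2 * Complex.exp (-2 * Complex.I * φ)) /
              (1 - Complex.exp (2 * Complex.I * φ))))) ∧
    -- the particular case, on all states
    Homodyne.Estimator.Equiv Set.univ
      (Homodyne.Estimator.mulDelta fun _ _ => 1)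
      (Homodyne.Estimator.ofFun fun _ _ => (1 / Real.pi : ℂ)) ∧
    Homodyne.Estimator.LimEquiv Set.univ
      (fun ε => Homodyne.Estimator.ofFun fun φ _ => Homodyne.poissonDelta ε φ)
      (Homodyne.Estimator.ofFun fun _ _ => (1 / Real.pi : ℂ)) := by
  refine ⟨fun f hf => ⟨?_, ?_, ?_, ?_⟩, Homodyne.equiv_mulDelta_one,
    Homodyne.limEquiv_poissonDelta⟩
  · simpa only [Homodyne.poissonEstimator_zero, pow_zero, one_mul] using
      Homodyne.equiv_poissonEstimator hf 0
  · simpa only [Homodyne.poissonEstimator_one, pow_one] using Homodyne.equiv_poissonEstimator hf 1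
  · simpa only [Homodyne.poissonEstimator_zero, pow_zero, one_mul, Nat.cast_zero,
      Homodyne.phaseExp_zero_left, mul_one] using Homodyne.limEquiv_poissonEstimator hf 0
  · simpa only [Homodyne.poissonEstimator_one, pow_one, Nat.cast_one, Homodyne.phaseExp_one] using
      Homodyne.limEquiv_poissonEstimator hf 1
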